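/- **Setting.** Let $\mathcal D_X$ be a probability measure on a measurable space $X$, let $H$ be a non-empty class of measurable hypotheses $h:X\to\{0,1\}$, put $\|h-h'\|=\Pr_{x\sim\mathcal D_X}[h(x)\ne h'(x)]$, let $B(\mu,R)$ be the closed ball of radius $R$ around $\mu\in H$, and let $N=N(H,\mathcal D_X,\eta)$ be the size of the smallest $\eta$-cover of $H$ by members of $H$, assumed finite. For a distribution $\lambda$ on finitely many members of $H$ let $r_\lambda(x)=\min\{\mathbb E_{h\sim\lambda}[h(x)],\,1-\mathbb E_{h\sim\lambda}[h(x)]\}$. A query distribution is a probability measure $q$ on $X$ with a bounded density $q(x)/\mathcal D_X(x)$; $\max_x q(x)/\mathcal D_X(x)$ denotes the essential supremum of the density. An active learner repeatedly draws a point $x$ from a query distribution of its choice and sees a fresh label $y\sim(Y\mid X=x)$; it *solves* $(H,\mathcal D_X,\eta,\varepsilon,\delta)$ with $m$ queries if, for every distribution of $(x,y)$ with marginal $\mathcal D_X$ such that some $h\in H$ has $\mathrm{err}(h)=\Pr[h(x)\ne y]\le\eta$, with probability at least $1-\delta$ it makes at most $m$ queries and outputs $\hat h\in H$ with $\mathrm{err}(\hat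 h)\le\eta+\varepsilon$. Write $\log^+t=\max\{1,\log t\}$. **Algorithm** (constants $\alpha,a,b,s>0$; $R=c_4\eta+c_5\varepsilon$). Compute a maximal $2\eta$-packing $H'\subseteq H$; put $w(h)=1$ for $h\in H'$ and $S=C=\emptyset$. Repeat $\lceil \frac a\beta\log^+\frac{|H'|}{\delta}\rceil$ times: let $\lambda=w/\sum_{H'}w$ and, for $S\subseteq H'$, let $\overline\lambda_S=\frac12\lambda$ on $S$ and $\overline\lambda_S=\lambda\cdot\frac{1-\lambda(S)/2}{1-\lambda(S)}$ on $H'\setminus S$; if some ball of radius $R$ has $\overline\lambda_S$-mass more than $80\%$, let $B(\mu',R)$, $\mu'\in H$, be a ball of radius $R$ of largest $\lambda$-mass, add $B(\mu',3R)\cap H'$ to $S$, and add $\mu'$ to $C$ (only the first $\lceil b\log^+\frac{|H'|}{\delta}\rceil$ centers are kept); choose a query distribution $q$ maximizing $\mathbb E_{x\sim q}[r_{\overline\lambda_S}(x)]-\frac{c_4}{20}\eta\max_x\frac{q(x)}{\mathcal D_X(x)}$ for the new $S$; query $x\sim q$, see $y$, and multiply $w(h)$ by $e^{-\alpha}$ for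 all $h\in H'$ with $h(x)\ne y$. Second stage: let $n=\lceil s\log^+\frac{|C|}{\delta}\rceil$ for the final $C$. As long as $C$ contains $h,h'$ with $\|h-h'\|>\eta+\varepsilon-(3\eta+3R)$, draw $n$ queries from $\mathcal D_X$ conditioned on $h(x)\ne h'(x)$ and remove from $C$ one of $h,h'$ that is wrong on at least half of them. Return any remaining member of $C$. **Theorem.** Let $c_4\ge300$, $c_5=\frac1{10}$ and $c_1>90c_4+80$. There are constants $\alpha,a,b,s>0$ and $K$, depending only on $c_1,c_4$, such that the following holds for all $X,\mathcal D_X,H$ as above and all $\eta\ge0$, $\varepsilon\ge c_1\eta$, $\delta\in(0,1)$, $\beta>0$. Suppose that for every distribution $\lambda$ on finitely many members of $H$ such that no ball of radius $c_4\eta+c_5\varepsilon$ centered in $H$ has $\lambda$-probability more than $80\%$, there is a query distribution $q$ with $$\mathbb E_{x\sim q}[r_\lambda(x)]-\frac{c_4}{20}\,\eta\,\max_x\frac{q(x)}{\mathcal D_X(x)}\ge\beta .$$ Then all objects that the algorithm has to choose exist, and, however ties are broken, the algorithm solves $(H,\mathcal D_X,\eta,\varepsilon,\delta)$ with at most $$K\left(\frac1\beta\log^+\frac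 N\delta+\log^+\frac N\delta\cdot\log^+\frac{\log^+N}{\delta}\right)$$ queries. -/

import Mathlib

open MeasureTheory ProbabilityTheory

noncomputable section

namespace ActiveLearning

/-- The logarithm as it is read inside `O(·)`-bounds: it is never smaller than `1`. -/
def logp (x : ℝ) : ℝ := max 1 (Real.log x)

/-! ### Active agnostic learning -/

/-- A randomized adaptive learner over the domain `X`: either it stops and outputs a hypothesis, or
it draws a point `x` from a query distribution `q` of its choice, is shown the label `y` of `x`,
and continues in a way that may depend on `x` and `y`. -/
inductive Learner (X : Type*) [MeasurableSpace X]
  | output (h : X → Bool) : Learner X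
  | query (q : Measure X) (next : X → Bool → Learner X) : Learner X

section Basic

variable {X : Type*} [MeasurableSpace X]

open Classical in
/-- The probability that a run of a learner, which has made `n` queries so far, ends with an output
`h` and a total number of queries `m` such that `E h m`. The label of a queried point `x` is a
fresh draw from `κ x`, the conditional law of the label given the point. -/
def Learner.prob (κ : Kernel X Bool) (E : (X → Bool) → ℕ → Prop) :
    Learner X → ℕ → ENNReal
  | .output h, n => if E h n then 1 else 0
  | .query q next, n => ∫⁻ x, ∫⁻ y, Learner.prob κ E (next x y) (n + 1) ∂(κ x) ∂q

/-- The distance `Pr_{x ∼ D}[h(x) ≠ h'(x)]`. -/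
def hdist (D : Measure X) (h h' : X → Bool) : ℝ := D.real {x | h x ≠ h' x}

/-- The error `Pr[h(x) ≠ y]` of `h` under the joint law of `(x, y)` with marginal `D` and
conditional label law `κ`. -/
def err (D : Measure X) (κ : Kernel X Bool) (h : X → Bool) : ℝ :=
  (D ⊗ₘ κ).real {p | h p.1 ≠ p.2}

/-- `A` solves the instance `(H, D, η, ε, δ)` with `m` queries. The joint distributions with
marginal `D` are `D ⊗ₘ κ` for Markov kernels `κ`. -/
def Solves (A : Learner X) (H : Set (X → Bool)) (D : Measure X) (η ε δ m : ℝ) : Prop :=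
  ∀ (κ : Kernel X Bool) [IsMarkovKernel κ], (∃ h ∈ H, err D κ h ≤ η) →
    ENNReal.ofReal (1 - δ) ≤
      A.prob κ (fun h n => (n : ℝ) ≤ m ∧ h ∈ H ∧ err D κ h ≤ η + ε) 0

/-- `F ⊆ H` is an `a`-cover of `H`. -/
def IsCover (D : Measure X) (H : Set (X → Bool)) (a : ℝ) (F : Finset (X → Bool)) : Prop :=
  (↑F : Set (X → Bool)) ⊆ H ∧ ∀ h ∈ H, ∃ h' ∈ F, hdist D h h' ≤ a

/-- `N(H, D, a)`: the size of the smallest (finite) `a`-cover of `H`. -/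
def coverNumber (D : Measure X) (H : Set (X → Bool)) (a : ℝ) : ℕ :=
  sInf {n | ∃ F, IsCover D H a F ∧ F.card = n}

/-- `F ⊆ H` is a maximal `a`-packing of `H`: distinct members are at distance more than `a`, and
no member of `H` can be added. -/
def IsMaxPacking (D : Measure X) (H : Set (X → Bool)) (a : ℝ) (F : Finset (X → Bool)) : Prop :=
  (↑F : Set (X → Bool)) ⊆ H ∧ (∀ h ∈ F, ∀ h' ∈ F, h ≠ h' → a < hdist D h h') ∧
    ∀ h ∈ H, h ∉ F → ∃ h' ∈ F, hdist D h h' ≤ a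

/-! ### Distributions on hypotheses and query distributions -/

/-- `lam` is a probability distribution on the finite set `F` of hypotheses. -/
def IsDistribution (F : Finset (X → Bool)) (lam : (X → Bool) → ℝ) : Prop :=
  (∀ h ∈ F, 0 ≤ lam h) ∧ ∑ h ∈ F, lam h = 1

open Classical in
/-- The mass that `lam`, carried by `F`, gives to the ball of radius `R` around `μ`. -/
def ballMass (D : Measure X) (F : Finset (X → Bool)) (lam : (X → Bool) → ℝ)
    (μ : X → Bool) (R : ℝ) : ℝ :=
  ∑ h ∈ F with hdist D h μ ≤ R, lam h

/-- `r(x) = min {E_{h ∼ lam}[h(x)], 1 - E_{h ∼ lam}[h(x)]}`. -/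
def minority (F : Finset (X → Bool)) (lam : (X → Bool) → ℝ) (x : X) : ℝ :=
  min (∑ h ∈ F with h x = true, lam h) (1 - ∑ h ∈ F with h x = true, lam h)

/-- `q` is a probability measure whose density `q(x) / D(x)` exists and is bounded. -/
def IsQueryDist (D q : Measure X) : Prop :=
  IsProbabilityMeasure q ∧ q ≪ D ∧ essSup (q.rnDeriv D) D ≠ ⊤

/-- `max_x q(x) / D(x)`. -/
def maxRatio (D q : Measure X) : ℝ := (essSup (q.rnDeriv D) D).toReal

/-- `E_{x ∼ q}[r(x)] - a · max_x q(x) / D(x)`. -/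
def queryValue (D : Measure X) (a : ℝ) (r : X → ℝ) (q : Measure X) : ℝ :=
  ∫ x, r x ∂q - a * maxRatio D q

/-- `q` maximizes `E_{x ∼ q}[r(x)] - a · max_x q(x) / D(x)` among the query distributions. -/
def IsOptimalQuery (D : Measure X) (a : ℝ) (r : X → ℝ) (q : Measure X) : Prop :=
  IsQueryDist D q ∧ ∀ q', IsQueryDist D q' → queryValue D a r q' ≤ queryValue D a r q

/-- Every distribution on (finitely many members of) `H` that gives no ball of radius
`c₄ η + c₅ ε` centered in `H` more than `80%` admits a query distribution of value at least `β`. -/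
def HasQueryValue (D : Measure X) (H : Set (X → Bool)) (c₄ c₅ η ε β : ℝ) : Prop :=
  ∀ (F : Finset (X → Bool)) (lam : (X → Bool) → ℝ), (↑F : Set (X → Bool)) ⊆ H →
    IsDistribution F lam →
    (∀ μ ∈ H, ballMass D F lam μ (c₄ * η + c₅ * ε) ≤ 4 / 5) →
    ∃ q, IsQueryDist D q ∧ β ≤ queryValue D (c₄ / 20 * η) (minority F lam) q

/-! ### The algorithm -/

/-- `w(h) / ∑_{h' ∈ F} w(h')`. -/
def posterior (F : Finset (X → Bool)) (w : (X → Bool) → ℝ) (h : X → Bool) : ℝ :=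
  w h / ∑ h' ∈ F, w h'

open Classical in
/-- The distribution `lam` capped on the set `S`. -/
def capped (lam : (X → Bool) → ℝ) (S : Finset (X → Bool)) (h : X → Bool) : ℝ :=
  if h ∈ S then 1 / 2 * lam h
  else lam h * ((1 - 1 / 2 * ∑ h' ∈ S, lam h') / (1 - ∑ h' ∈ S, lam h'))

end Basic

/-- The numerical constants of the algorithm: the step size `α` of the multiplicative update, and
the constant factors in the number of rounds, in the number of centers that are kept, and in the
number of samples per comparison in the second stage. -/
structure Constants where
  α : ℝ
  rounds : ℝ
  centers : ℝ
  samples : ℝ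

/-- What the algorithm computes without querying, where its description leaves the result open only
up to ties: a maximal `2η`-packing `H'`; for all weights `w` on `H'`, the center in `H` of a
heaviest ball of radius `R`; for all weights and all capped sets `S`, an optimal query distribution
(penalty factor `a`); in the second stage, some pair of candidates at distance more than `T` as long
as there is one, and some remaining candidate in the end. -/
structure Choices {X : Type*} [MeasurableSpace X] (D : Measure X) (H : Set (X → Bool))
    (η R a T : ℝ) where
  packing : Finset (X → Bool)
  packing_spec : IsMaxPacking D H (2 * η) packing
  center : ((X → Bool) → ℝ) → (X → Bool)
  center_mem : ∀ w, center w ∈ H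
  center_heaviest : ∀ w, ∀ μ ∈ H,
    ballMass D packing (posterior packing w) μ R ≤
      ballMass D packing (posterior packing w) (center w) R
  queryDist : ((X → Bool) → ℝ) → Finset (X → Bool) → Measure X
  queryDist_optimal : ∀ w, ∀ S ⊆ packing,
    IsOptimalQuery D a (minority packing (capped (posterior packing w) S)) (queryDist w S)
  pair : Finset (X → Bool) → (X → Bool) × (X → Bool)
  pair_spec : ∀ C : Finset (X → Bool), (∃ h ∈ C, ∃ h' ∈ C, T < hdist D h h') →
    (pair C).1 ∈ C ∧ (pair C).2 ∈ C ∧ T < hdist D (pair C).1 (pair C).2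
  pick : Finset (X → Bool) → (X → Bool)
  pick_mem : ∀ C : Finset (X → Bool), C.Nonempty → pick C ∈ C

section Algorithm

variable {X : Type*} [MeasurableSpace X] {D : Measure X} {H : Set (X → Bool)} {η R a T : ℝ}

/-- Draw `n` queries from `q`, add the number of mistakes of `h` to `m`, and go on with the
result. -/
def countMistakes (q : Measure X) (h : X → Bool) (next : ℕ → Learner X) : ℕ → ℕ → Learner X
  | 0, m => next m
  | n + 1, m => .query q fun x y =>
      countMistakes q h next n (if h x = y then m else m + 1)

open Classical in
/-- The second stage, on the candidates `C` and with at most `j` comparisons: as long as two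
candidates `h, h'` are at distance more than `T`, draw `n` samples from `D` conditioned on
`h(x) ≠ h'(x)` and remove one of the two that is wrong on at least half of them; then return a
remaining candidate. -/
def stageTwo (ch : Choices D H η R a T) (n : ℕ) : ℕ → Finset (X → Bool) → Learner X
  | 0, C => .output (ch.pick C)
  | j + 1, C =>
      if ∃ h ∈ C, ∃ h' ∈ C, T < hdist D h h' then
        countMistakes (cond D {x | (ch.pair C).1 x ≠ (ch.pair C).2 x}) (ch.pair C).1
          (fun m => stageTwo ch n j
            (C.erase (if n ≤ 2 * m then (ch.pair C).1 else (ch.pair C).2))) n 0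
      else .output (ch.pick C)

open Classical in
/-- The capped set after the test of a round: if some ball of radius `R` has more than `80%` under
the capped distribution, the ball of radius `3R` around the center of the heaviest ball is added. -/
def nextS (ch : Choices D H η R a T) (w : (X → Bool) → ℝ) (S : Finset (X → Bool)) :
    Finset (X → Bool) :=
  if ∃ μ ∈ H, 4 / 5 < ballMass D ch.packing (capped (posterior ch.packing w) S) μ R then
    S ∪ ch.packing.filter fun h => hdist D h (ch.center w) ≤ 3 * R
  else S

open Classical in
/-- The set of centers after the test of a round; only the first `cap` centers are kept. -/
def nextC (ch : Choices D H η R a T) (cap : ℕ) (w : (X → Bool) → ℝ)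
    (S C : Finset (X → Bool)) : Finset (X → Bool) :=
  if (∃ μ ∈ H, 4 / 5 < ballMass D ch.packing (capped (posterior ch.packing w) S) μ R) ∧
      C.card < cap then
    insert (ch.center w) C
  else C

open Classical in
/-- The multiplicative update of the weights on the packing `F` after the label `y` of `x` was
seen. -/
def nextW (F : Finset (X → Bool)) (α : ℝ) (w : (X → Bool) → ℝ) (x : X) (y : Bool)
    (h : X → Bool) : ℝ :=
  if h ∈ F ∧ h x ≠ y then Real.exp (-α) * w h else w h

/-- The first stage with `k` rounds left, current weights `w`, capped set `S` and centers `C`,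
followed by `finish`, applied to the centers found. -/
def stageOne (ch : Choices D H η R a T) (α : ℝ) (cap : ℕ)
    (finish : Finset (X → Bool) → Learner X) :
    ℕ → ((X → Bool) → ℝ) → Finset (X → Bool) → Finset (X → Bool) → Learner X
  | 0, _, _, C => finish C
  | k + 1, w, S, C =>
      .query (ch.queryDist w (nextS ch w S)) fun x y =>
        stageOne ch α cap finish k (nextW ch.packing α w x y) (nextS ch w S)
          (nextC ch cap w S C)

/-- The whole algorithm: about `(1/β) log (|H'|/δ)` rounds of the first stage, of which the first
`O(log (|H'|/δ))` centers are passed to the second stage, with `O(log (|C|/δ))` samples per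
comparison. -/
def algorithm (ch : Choices D H η R a T) (p : Constants) (β δ : ℝ) : Learner X :=
  stageOne ch p.α ⌈p.centers * logp (ch.packing.card / δ)⌉₊
    (fun C => stageTwo ch ⌈p.samples * logp (C.card / δ)⌉₊ C.card C)
    ⌈p.rounds * (1 / β) * logp (ch.packing.card / δ)⌉₊ (fun _ => 1) ∅ ∅

end Algorithm

/-- The distance threshold of the second stage. The centers found by the first stage contain one
within `3R` of a hypothesis of error at most `3η`, hence of error at most `3η + 3R`; a candidate
within the threshold of that one has error at most `η + ε`. -/
def threshold (η ε R : ℝ) : ℝ := η + ε - (3 * η + 3 * R)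

end ActiveLearning

end

/-!
Let `t` be a member of the packing near the best hypothesis, and let `λ` be the current
distribution. The potential `1 / (λ(t) · λ(t | Sᶜ))` starts at the square of the size of the packing
and is at least `1` as long as `t` is not capped. In a round of the first stage it decreases in
expectation by a factor `exp (-θ β)`, with `θ = 1 - exp (-2 α)`: a draw on which `t` disagrees with
much of the capped distribution decreases it if the label agrees with `t`, and the penalty in the
value of the query distribution pays for the draws on which the label contradicts `t`. A new center
decreases it by another factor `2 / 5`, since a ball with more than `80%` of the capped mass carries
more than `60%` of the mass of `λ` and of the uncapped mass. Hence with high probability `t` is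
capped before the rounds and the centers run out, and then some center is within `3 R` of `t`. In
the second stage this center rarely loses a comparison against a distant candidate, by a Chernoff
bound, so the surviving candidates are close to it.
-/

namespace ActiveLearning

/-! ### Distances and errors -/

section Distances

variable {X : Type*} [MeasurableSpace X] {D : Measure X}

lemma hdist_self (D : Measure X) (h : X → Bool) : hdist D h h = 0 := by
  simp [hdist]

lemma hdist_comm (D : Measure X) (h g : X → Bool) : hdist D h g = hdist D g h := by
  simp only [hdist, ne_comm]

lemma hdist_triangle (D : Measure X) [IsFiniteMeasure D] (h g k : X → Bool) :
    hdist D h k ≤ hdist D h g + hdist D g k := by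
  have hsub : {x | h x ≠ k x} ⊆ {x | h x ≠ g x} ∪ {x | g x ≠ k x} := fun x hx =>
    or_iff_not_imp_left.2 fun hg e => hx ((not_not.1 hg).trans e)
  exact (measureReal_mono hsub).trans (measureReal_union_le _ _)

lemma measurableSet_ne {h g : X → Bool} (hh : Measurable h) (hg : Measurable g) :
    MeasurableSet {x | h x ≠ g x} :=
  (measurableSet_eq_fun hh hg).compl

lemma measurableSet_mistakes {h : X → Bool} (hh : Measurable h) :
    MeasurableSet {p : X × Bool | h p.1 ≠ p.2} :=
  measurableSet_ne (hh.comp measurable_fst) measurable_snd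

/-- The conditional probability that `h` mislabels the point `x`. The error of `h` is its mean
over `D`, and its mean over a query distribution is the chance that a query penalizes `h`. -/
noncomputable def noise (κ : Kernel X Bool) (h : X → Bool) (x : X) : ℝ := (κ x).real {y | h x ≠ y}

lemma noise_nonneg (κ : Kernel X Bool) (h : X → Bool) (x : X) : 0 ≤ noise κ h x :=
  measureReal_nonneg

variable (κ : Kernel X Bool) [IsMarkovKernel κ] {h g : X → Bool}

lemma noise_le_one (h : X → Bool) (x : X) : noise κ h x ≤ 1 := measureReal_le_one

lemma measurable_noise (hh : Measurable h) : Measurable (noise κ h) :=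
  (Kernel.measurable_kernel_prodMk_left (κ := κ) (measurableSet_mistakes hh)).ennreal_toReal

lemma integrable_noise (hh : Measurable h) (q : Measure X) [IsFiniteMeasure q] :
    Integrable (noise κ h) q :=
  Integrable.of_mem_Icc 0 1 (measurable_noise κ hh).aemeasurable
    (.of_forall fun x => ⟨noise_nonneg κ h x, noise_le_one κ h x⟩)

lemma err_eq_integral_noise [SFinite D] (hh : Measurable h) :
    err D κ h = ∫ x, noise κ h x ∂D := by
  have hm := Kernel.measurable_kernel_prodMk_left (κ := κ) (measurableSet_mistakes hh)
  rw [err, measureReal_def, Measure.compProd_apply (measurableSet_mistakes hh)]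
  exact (integral_toReal hm.aemeasurable (.of_forall fun x => measure_lt_top _ _)).symm

lemma err_nonneg (D : Measure X) (κ : Kernel X Bool) (h : X → Bool) : 0 ≤ err D κ h :=
  measureReal_nonneg

lemma err_le_err_add_hdist [IsFiniteMeasure D] (hh : Measurable h) (hg : Measurable g) :
    err D κ h ≤ err D κ g + hdist D g h := by
  have hsub : {p : X × Bool | h p.1 ≠ p.2} ⊆
      {p | g p.1 ≠ p.2} ∪ Prod.fst ⁻¹' {x | g x ≠ h x} := fun p hp =>
    or_iff_not_imp_left.2 fun hg e => hp (e.symm.trans (not_not.1 hg))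
  have hd : hdist D g h = (D ⊗ₘ κ).real (Prod.fst ⁻¹' {x | g x ≠ h x}) := by
    rw [hdist, measureReal_def, measureReal_def, ← Measure.fst_apply (measurableSet_ne hg hh),
      Measure.fst_compProd]
  rw [hd]
  exact (measureReal_mono hsub).trans (measureReal_union_le _ _)

end Distances

/-! ### Packings, covers and balls -/

section Packings

variable {X : Type*} [MeasurableSpace X] {D : Measure X} {H : Set (X → Bool)} {a : ℝ}
  {P F : Finset (X → Bool)}

/-- `P` is an `a`-packing of `H` by members of `H`: any two of them are at distance more than
`a`. The packings that the algorithm uses are the maximal ones, `IsMaxPacking`. -/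
def IsPacking (D : Measure X) (H : Set (X → Bool)) (a : ℝ) (P : Finset (X → Bool)) : Prop :=
  (↑P : Set (X → Bool)) ⊆ H ∧ (↑P : Set (X → Bool)).Pairwise fun h g => a < hdist D h g

lemma IsMaxPacking.isPacking (hP : IsMaxPacking D H a P) : IsPacking D H a P :=
  ⟨hP.1, fun h hh g hg hne => hP.2.1 h hh g hg hne⟩

lemma IsMaxPacking.exists_hdist_le (hP : IsMaxPacking D H a P) (ha : 0 ≤ a) {h : X → Bool}
    (hh : h ∈ H) : ∃ g ∈ P, hdist D h g ≤ a := by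
  by_cases hhP : h ∈ P
  · exact ⟨h, hhP, (hdist_self D h).trans_le ha⟩
  · exact hP.2.2 h hh hhP

lemma IsPacking.card_le_card_cover [IsFiniteMeasure D] (hP : IsPacking D H (2 * a) P)
    (hF : IsCover D H a F) : P.card ≤ F.card := by
  choose! f hfF hf using hF.2
  refine Finset.card_le_card_of_injOn f (fun h hh => hfF h (hP.1 hh)) fun h hh g hg e => ?_
  by_contra hne
  have hclose : hdist D h g ≤ 2 * a :=
    calc hdist D h g ≤ hdist D h (f h) + hdist D (f h) g := hdist_triangle D h (f h) g
      _ ≤ a + a := by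
        refine add_le_add (hf h (hP.1 hh)) ?_
        rw [e, hdist_comm]
        exact hf g (hP.1 hg)
      _ = 2 * a := (two_mul a).symm
  exact (hP.2 hh hg hne).not_ge hclose

open Classical in
lemma IsPacking.insert (hP : IsPacking D H a P) {h : X → Bool} (hh : h ∈ H)
    (hfar : ∀ g ∈ P, a < hdist D h g) : IsPacking D H a (insert h P) := by
  refine ⟨?_, ?_⟩ <;> rw [Finset.coe_insert]
  · exact Set.insert_subset hh hP.1
  · exact hP.2.insert fun g hg _ => ⟨hfar g hg, (hfar g hg).trans_eq (hdist_comm D h g)⟩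

lemma exists_isMaxPacking [IsFiniteMeasure D] (hF : IsCover D H a F) :
    ∃ P, IsMaxPacking D H (2 * a) P := by
  classical
  let cards : Set ℕ := {n | ∃ P, IsPacking D H (2 * a) P ∧ P.card = n}
  have hbdd : BddAbove cards :=
    ⟨F.card, by rintro _ ⟨P, hP, rfl⟩; exact hP.card_le_card_cover hF⟩
  obtain ⟨P, hP, hcard⟩ : sSup cards ∈ cards :=
    Nat.sSup_mem ⟨0, ∅, ⟨by simp, by simp⟩, Finset.card_empty⟩ hbdd
  refine ⟨P, hP.1, fun h hh g hg hne => hP.2 hh hg hne, fun h hh hhP => ?_⟩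
  by_contra! hfar
  have hle : (insert h P).card ≤ sSup cards := le_csSup hbdd ⟨_, hP.insert hh hfar, rfl⟩
  rw [Finset.card_insert_of_notMem hhP] at hle
  omega

lemma IsMaxPacking.card_le_coverNumber [IsFiniteMeasure D] (hP : IsMaxPacking D H (2 * a) P)
    (hcov : ∃ F, IsCover D H a F) : P.card ≤ coverNumber D H a := by
  obtain ⟨F₀, hF₀⟩ := hcov
  obtain ⟨F, hF, hcard⟩ := Nat.sInf_mem (s := {n | ∃ F, IsCover D H a F ∧ F.card = n})
    ⟨_, F₀, hF₀, rfl⟩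
  exact (hP.isPacking.card_le_card_cover hF).trans hcard.le

open Classical in
/-- The members of `F` in the ball of radius `R` around `μ`, whose mass is `ballMass`. -/
noncomputable def ball (D : Measure X) (F : Finset (X → Bool)) (μ : X → Bool) (R : ℝ) :
    Finset (X → Bool) :=
  F.filter fun h => hdist D h μ ≤ R

lemma mem_ball {μ h : X → Bool} {R : ℝ} : h ∈ ball D F μ R ↔ h ∈ F ∧ hdist D h μ ≤ R := by
  classical exact Finset.mem_filter

lemma ball_subset (D : Measure X) (F : Finset (X → Bool)) (μ : X → Bool) (R : ℝ) :
    ball D F μ R ⊆ F := by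
  classical exact Finset.filter_subset _ F

lemma ballMass_eq_sum_ball (D : Measure X) (F : Finset (X → Bool)) (lam : (X → Bool) → ℝ)
    (μ : X → Bool) (R : ℝ) : ballMass D F lam μ R = ∑ h ∈ ball D F μ R, lam h := rfl

lemma exists_heaviest_ball (D : Measure X) (hH : H.Nonempty) (F : Finset (X → Bool))
    (lam : (X → Bool) → ℝ) (R : ℝ) :
    ∃ c ∈ H, ∀ μ ∈ H, ballMass D F lam μ R ≤ ballMass D F lam c R := by
  have hfin : ((ball D F · R) '' H).Finite :=
    F.powerset.finite_toSet.subset <| by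
      rintro _ ⟨μ, -, rfl⟩
      exact Finset.mem_powerset.2 (ball_subset D F μ R)
  obtain ⟨_, ⟨c, hc, rfl⟩, hmax⟩ :=
    Set.exists_max_image _ (fun G => ∑ h ∈ G, lam h) hfin (hH.image _)
  exact ⟨c, hc, fun μ hμ => hmax _ ⟨μ, hμ, rfl⟩⟩

end Packings

/-! ### Query distributions -/

section QueryDistributions

variable {X : Type*} [MeasurableSpace X] {D q : Measure X}

lemma IsQueryDist.le_smul [SigmaFinite D] (hq : IsQueryDist D q) :
    q ≤ essSup (q.rnDeriv D) D • D := by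
  have := hq.1
  conv_lhs => rw [← Measure.withDensity_rnDeriv_eq q D hq.2.1]
  rw [← withDensity_const]
  exact withDensity_mono (ENNReal.ae_le_essSup _)

lemma IsQueryDist.integrable [SigmaFinite D] (hq : IsQueryDist D q) {f : X → ℝ}
    (hf : Integrable f D) : Integrable f q :=
  (hf.smul_measure hq.2.2).mono_measure hq.le_smul

lemma IsQueryDist.integral_le [SigmaFinite D] (hq : IsQueryDist D q) {f : X → ℝ}
    (hf0 : ∀ x, 0 ≤ f x) (hf : Integrable f D) :
    ∫ x, f x ∂q ≤ maxRatio D q * ∫ x, f x ∂D := by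
  have h := integral_mono_measure hq.le_smul (.of_forall hf0) (hf.smul_measure hq.2.2)
  rwa [integral_smul_measure, smul_eq_mul] at h

lemma essSup_rnDeriv_cond_le [SigmaFinite D] {A : Set X} (hA : MeasurableSet A)
    (hA0 : D A ≠ 0) : essSup ((cond D A).rnDeriv D) D ≤ (D A)⁻¹ := by
  refine essSup_le_of_ae_le _ ?_
  filter_upwards [Measure.rnDeriv_smul_left_of_ne_top' (D.restrict A) D (ENNReal.inv_ne_top.2 hA0),
    Measure.rnDeriv_restrict_self D hA] with x hx hxA
  rw [ProbabilityTheory.cond, hx, Pi.smul_apply, hxA, smul_eq_mul]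
  exact mul_le_of_le_one_right' (Set.indicator_le_self' (fun _ _ => zero_le) x)

variable {a V : ℝ} {r : X → ℝ}

lemma isQueryDist_cond [IsFiniteMeasure D] {A : Set X} (hA : MeasurableSet A) (hA0 : D A ≠ 0) :
    IsQueryDist D (cond D A) :=
  ⟨cond_isProbabilityMeasure hA0, cond_absolutelyContinuous,
    ne_top_of_le_ne_top (ENNReal.inv_ne_top.2 hA0) (essSup_rnDeriv_cond_le hA hA0)⟩

lemma integral_cond (D : Measure X) (A : Set X) (f : X → ℝ) :
    ∫ x, f x ∂(cond D A) = (D.real A)⁻¹ * ∫ x in A, f x ∂D := by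
  rw [ProbabilityTheory.cond, integral_smul_measure, smul_eq_mul, ENNReal.toReal_inv,
    measureReal_def]

lemma le_queryValue_cond [SigmaFinite D] {A : Set X} (hA : MeasurableSet A) (hA0 : D A ≠ 0)
    (ha : 0 ≤ a) (r : X → ℝ) :
    (D.real A)⁻¹ * (∫ x in A, r x ∂D - a) ≤ queryValue D a r (cond D A) := by
  have hratio : maxRatio D (cond D A) ≤ (D.real A)⁻¹ := by
    rw [measureReal_def, ← ENNReal.toReal_inv]
    exact ENNReal.toReal_mono (ENNReal.inv_ne_top.2 hA0) (essSup_rnDeriv_cond_le hA hA0)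
  rw [queryValue, integral_cond, mul_sub, mul_comm _ a]
  gcongr

-- Weak duality for maximizing `queryValue`: the excess of `r` over `V` must pay for the penalty.
lemma IsQueryDist.queryValue_le [IsFiniteMeasure D] (hq : IsQueryDist D q) (hr : Integrable r D)
    (hV : ∫ x, max (r x - V) 0 ∂D ≤ a) : queryValue D a r q ≤ V := by
  have := hq.1
  have hexcess : Integrable (fun x => max (r x - V) 0) D := (hr.sub (integrable_const V)).pos_part
  have hle : ∫ x, r x ∂q - V ≤ a * maxRatio D q :=
    calc ∫ x, r x ∂q - V = ∫ x, (r x - V) ∂q := by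
          rw [integral_sub (hq.integrable hr) (integrable_const V), integral_const, probReal_univ,
            one_smul]
      _ ≤ ∫ x, max (r x - V) 0 ∂q :=
          integral_mono ((hq.integrable hr).sub (integrable_const V)) (hq.integrable hexcess)
            fun x => le_max_left _ _
      _ ≤ maxRatio D q * ∫ x, max (r x - V) 0 ∂D :=
          hq.integral_le (fun x => le_max_right _ _) hexcess
      _ ≤ a * maxRatio D q := by
          rw [mul_comm a]
          exact mul_le_mul_of_nonneg_left hV ENNReal.toReal_nonneg
  rw [queryValue]
  linarith

lemma integral_max_sub_zero [IsFiniteMeasure D] (hr : Measurable r) (hrD : Integrable r D) (V : ℝ) :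
    ∫ x, max (r x - V) 0 ∂D = ∫ x in {x | V < r x}, r x ∂D - V * D.real {x | V < r x} := by
  have hind : (fun x => max (r x - V) 0) = {x | V < r x}.indicator fun x => r x - V := by
    ext x
    by_cases hx : V < r x
    · rw [Set.indicator_of_mem (by exact hx), max_eq_left (sub_nonneg.2 hx.le)]
    · rw [Set.indicator_of_notMem (by exact hx), max_eq_right (sub_nonpos.2 (not_lt.1 hx))]
  rw [hind, integral_indicator (measurableSet_lt measurable_const hr),
    integral_sub hrD.integrableOn (integrable_const V), setIntegral_const, smul_eq_mul, mul_comm V]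

lemma finite_setOf_superlevel {X : Type*} {r : X → ℝ} (hfin : (Set.range r).Finite) :
    {A | ∃ s, A = {x | s < r x}}.Finite := by
  refine (hfin.finite_subsets.image (r ⁻¹' ·)).subset ?_
  rintro _ ⟨s, rfl⟩
  refine ⟨Set.range r ∩ Set.Ioi s, Set.inter_subset_left, ?_⟩
  ext x
  simp

lemma exists_isOptimalQuery [IsProbabilityMeasure D] (ha : 0 ≤ a) (hr : Measurable r)
    (hfin : (Set.range r).Finite) : ∃ q, IsOptimalQuery D a r q := by
  obtain ⟨B, hB⟩ := hfin.bddAbove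
  obtain ⟨b, hb⟩ := hfin.bddBelow
  have hrD : Integrable r D := Integrable.of_mem_Icc b B hr.aemeasurable
    (.of_forall fun x => ⟨hb ⟨x, rfl⟩, hB ⟨x, rfl⟩⟩)
  have hmeas (s : ℝ) : MeasurableSet {x | s < r x} := measurableSet_lt measurable_const hr
  let levels : Set (Set X) := {A | ∃ s, A = {x | s < r x}} ∩ {A | D A ≠ 0}
  have hne : levels.Nonempty := by
    refine ⟨{x | b - 1 < r x}, ⟨_, rfl⟩, ?_⟩
    have huniv : {x | b - 1 < r x} = Set.univ :=
      Set.eq_univ_of_forall fun x => (sub_one_lt b).trans_le (hb ⟨x, rfl⟩)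
    simp [huniv]
  obtain ⟨A, ⟨⟨s, rfl⟩, hA0⟩, hmax⟩ := Set.exists_max_image levels
    (fun A => (D.real A)⁻¹ * (∫ x in A, r x ∂D - a))
    ((finite_setOf_superlevel hfin).subset Set.inter_subset_left) hne
  refine ⟨cond D {x | s < r x}, isQueryDist_cond (hmeas s) hA0, fun q hq =>
    le_trans ?_ (le_queryValue_cond (hmeas s) hA0 ha r)⟩
  set V := (D.real {x | s < r x})⁻¹ * (∫ x in {x | s < r x}, r x ∂D - a)
  refine hq.queryValue_le hrD ?_
  rw [integral_max_sub_zero hr hrD]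
  by_cases h0 : D {x | V < r x} = 0
  · rw [setIntegral_measure_zero r h0, measureReal_def, h0]
    simpa using ha
  · have hle := hmax _ ⟨⟨V, rfl⟩, h0⟩
    have hpos : 0 < D.real {x | V < r x} := ENNReal.toReal_pos h0 (measure_ne_top _ _)
    rw [inv_mul_le_iff₀ hpos] at hle
    rw [mul_comm V]
    linarith

variable {F : Finset (X → Bool)}

lemma measurable_sum_filter {p : (X → Bool) → X → Prop} [∀ h x, Decidable (p h x)]
    (hp : ∀ h ∈ F, MeasurableSet {x | p h x}) (lam : (X → Bool) → ℝ) :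
    Measurable fun x => ∑ h ∈ F with p h x, lam h := by
  simp only [Finset.sum_filter]
  exact Finset.measurable_sum _ fun h hh =>
    Measurable.ite (hp h hh) measurable_const measurable_const

lemma measurable_minority (hF : ∀ h ∈ F, Measurable h) (lam : (X → Bool) → ℝ) :
    Measurable (minority F lam) := by
  have h := measurable_sum_filter (F := F) (p := fun h x => h x = true)
    (fun h hh => measurableSet_eq_fun (hF h hh) measurable_const) lam
  exact h.min (measurable_const.sub h)

lemma finite_range_minority {X : Type*} (F : Finset (X → Bool)) (lam : (X → Bool) → ℝ) :
    (Set.range (minority F lam)).Finite := by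
  refine (F.powerset.finite_toSet.image fun G =>
    min (∑ h ∈ G, lam h) (1 - ∑ h ∈ G, lam h)).subset ?_
  rintro _ ⟨x, rfl⟩
  exact ⟨F.filter fun h => h x = true, Finset.mem_powerset.2 (Finset.filter_subset _ F), rfl⟩

lemma nonempty_choices [IsProbabilityMeasure D] {H : Set (X → Bool)} (hH : H.Nonempty)
    (hmeas : ∀ h ∈ H, Measurable h) {η : ℝ} (hcov : ∃ F, IsCover D H η F) (R : ℝ) (ha : 0 ≤ a)
    (T : ℝ) : Nonempty (Choices D H η R a T) := by
  obtain ⟨F, hF⟩ := hcov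
  obtain ⟨P, hP⟩ := exists_isMaxPacking hF
  choose c hc hmax using fun w => exists_heaviest_ball D hH P (posterior P w) R
  choose q hq using fun (w : (X → Bool) → ℝ) (S : Finset (X → Bool)) =>
    exists_isOptimalQuery (D := D) ha
      (measurable_minority (fun h hh => hmeas h (hP.1 hh)) (capped (posterior P w) S))
      (finite_range_minority P (capped (posterior P w) S))
  have hpair (C : Finset (X → Bool)) (hC : ∃ h ∈ C, ∃ g ∈ C, T < hdist D h g) :
      ∃ p : (X → Bool) × (X → Bool), p.1 ∈ C ∧ p.2 ∈ C ∧ T < hdist D p.1 p.2 := by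
    obtain ⟨h, hh, g, hg, hT⟩ := hC
    exact ⟨(h, g), hh, hg, hT⟩
  have hpick (C : Finset (X → Bool)) (hC : C.Nonempty) : ∃ h, h ∈ C := hC
  choose! pair hpair using hpair
  choose! pick hpick using hpick
  exact ⟨⟨P, hP, c, hc, hmax, q, fun w S _ => hq w S, pair, hpair, pick, hpick⟩⟩

end QueryDistributions

/-! ### Failure probabilities of learners -/

section Learners

variable {X : Type*} [MeasurableSpace X]

/-- A run of `A` that has made `n` queries so far misses the event `E` with probability at most
`b`. It is a lower bound for the success probability `Learner.prob`, which is an integral of a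
function that need not be measurable. -/
def Learner.FailureLE (A : Learner X) (κ : Kernel X Bool) (E : (X → Bool) → ℕ → Prop) (n : ℕ)
    (b : ℝ) : Prop :=
  ENNReal.ofReal (1 - b) ≤ A.prob κ E n

namespace Learner

variable {A : Learner X} {κ : Kernel X Bool} {E : (X → Bool) → ℕ → Prop} {n : ℕ} {b b' : ℝ}

lemma FailureLE.mono (hA : A.FailureLE κ E n b) (hb : b ≤ b') : A.FailureLE κ E n b' :=
  (ENNReal.ofReal_le_ofReal (sub_le_sub_left hb 1)).trans hA

lemma failureLE_of_one_le (hb : 1 ≤ b) : A.FailureLE κ E n b := by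
  rw [FailureLE, ENNReal.ofReal_of_nonpos (sub_nonpos.2 hb)]
  exact zero_le

lemma failureLE_output {h : X → Bool} (hE : E h n) (hb : 0 ≤ b) :
    (output h).FailureLE κ E n b := by
  rw [FailureLE, prob, if_pos hE]
  exact ENNReal.ofReal_le_one.2 (sub_le_self 1 hb)

end Learner

lemma ofReal_integral_le_lintegral {Y : Type*} [MeasurableSpace Y] {q : Measure Y} {f : Y → ℝ}
    (hf : Integrable f q) : ENNReal.ofReal (∫ y, f y ∂q) ≤ ∫⁻ y, ENNReal.ofReal (f y) ∂q :=
  calc ENNReal.ofReal (∫ y, f y ∂q) ≤ ENNReal.ofReal (∫ y, max (f y) 0 ∂q) :=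
        ENNReal.ofReal_le_ofReal (integral_mono hf hf.pos_part fun y => le_max_left _ _)
    _ = ∫⁻ y, ENNReal.ofReal (max (f y) 0) ∂q :=
        ofReal_integral_eq_lintegral_ofReal hf.pos_part (.of_forall fun y => le_max_right _ _)
    _ = ∫⁻ y, ENNReal.ofReal (f y) ∂q := by simp [ENNReal.ofReal_max]

lemma integral_one_sub {Y : Type*} [MeasurableSpace Y] {q : Measure Y} [IsProbabilityMeasure q]
    {f : Y → ℝ} (hf : Integrable f q) : ∫ y, (1 - f y) ∂q = 1 - ∫ y, f y ∂q := by
  rw [integral_sub (integrable_const 1) hf, integral_const, probReal_univ, one_smul]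

variable {κ : Kernel X Bool} [IsMarkovKernel κ] {E : (X → Bool) → ℕ → Prop} {n : ℕ} {b : ℝ}
  {q : Measure X} [IsProbabilityMeasure q]

namespace Learner

variable {next : X → Bool → Learner X}

lemma failureLE_query {g : X → Bool → ℝ} {G : X → ℝ}
    (hnext : ∀ x y, (next x y).FailureLE κ E (n + 1) (g x y)) (hG : Integrable G q)
    (hgG : ∀ x, ∫ y, g x y ∂κ x ≤ G x) (hb : ∫ x, G x ∂q ≤ b) :
    (query q next).FailureLE κ E n b := by
  have hlabel (x : X) :
      ENNReal.ofReal (1 - G x) ≤ ∫⁻ y, (next x y).prob κ E (n + 1) ∂κ x :=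
    calc ENNReal.ofReal (1 - G x) ≤ ENNReal.ofReal (∫ y, (1 - g x y) ∂κ x) := by
          rw [integral_one_sub .of_finite]
          exact ENNReal.ofReal_le_ofReal (sub_le_sub_left (hgG x) 1)
      _ ≤ ∫⁻ y, ENNReal.ofReal (1 - g x y) ∂κ x := ofReal_integral_le_lintegral .of_finite
      _ ≤ ∫⁻ y, (next x y).prob κ E (n + 1) ∂κ x := lintegral_mono (hnext x)
  calc ENNReal.ofReal (1 - b) ≤ ENNReal.ofReal (∫ x, (1 - G x) ∂q) := by
        rw [integral_one_sub hG]
        exact ENNReal.ofReal_le_ofReal (sub_le_sub_left hb 1)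
    _ ≤ ∫⁻ x, ENNReal.ofReal (1 - G x) ∂q :=
        ofReal_integral_le_lintegral ((integrable_const 1).sub hG)
    _ ≤ (query q next).prob κ E n := by
        rw [prob]
        exact lintegral_mono hlabel

lemma failureLE_query_const (hnext : ∀ x y, (next x y).FailureLE κ E (n + 1) b) :
    (query q next).FailureLE κ E n b :=
  failureLE_query hnext (integrable_const b)
    (fun x => by rw [integral_const, probReal_univ, one_smul])
    (by rw [integral_const, probReal_univ, one_smul])

end Learner

variable {h : X → Bool}

lemma integral_label (κ : Kernel X Bool) [IsMarkovKernel κ] (h : X → Bool) (x : X) (g : Bool → ℝ) :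
    ∫ y, g y ∂κ x = (1 - noise κ h x) * g (h x) + noise κ h x * g (!h x) := by
  have hwrong : noise κ h x = (κ x).real {!h x} := by
    rw [noise]
    congr 1
    ext y
    cases h x <;> cases y <;> simp
  have hright : 1 - noise κ h x = (κ x).real {h x} := by
    rw [hwrong, ← probReal_compl_eq_one_sub (measurableSet_singleton _)]
    congr 1
    ext y
    cases h x <;> cases y <;> simp
  rw [hright, hwrong, integral_fintype .of_finite, Fintype.sum_bool]
  cases h x
  · exact add_comm _ _
  · rfl

lemma integral_add_const_mul {f : X → ℝ} (hf : Integrable f q) (a b : ℝ) :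
    ∫ x, (a + b * f x) ∂q = a + b * ∫ x, f x ∂q := by
  rw [integral_add (integrable_const a) (hf.const_mul b), integral_const, integral_const_mul,
    probReal_univ, one_smul]

lemma integral_noise_nonneg (κ : Kernel X Bool) (h : X → Bool) (q : Measure X) :
    0 ≤ ∫ x, noise κ h x ∂q :=
  integral_nonneg (noise_nonneg κ h)

lemma integral_noise_le_one (hh : Measurable h) : ∫ x, noise κ h x ∂q ≤ 1 :=
  (integral_mono (integrable_noise κ hh q) (integrable_const 1) (noise_le_one κ h)).trans_eq
    (by simp)

/-! ### Counting mistakes -/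

-- The number of mistakes in `k` draws is binomial, and its moment generating function at `A` is
-- the `k`-th power of `1 + P (A - 1)`, where `P` is the probability of a mistake.
lemma failureLE_countMistakes (hh : Measurable h) {next : ℕ → Learner X} {c A : ℝ} :
    ∀ k m n : ℕ, (∀ m, (next m).FailureLE κ E (n + k) (b + c * A ^ m)) →
      (countMistakes q h next k m).FailureLE κ E n
        (b + c * A ^ m * (1 + (∫ x, noise κ h x ∂q) * (A - 1)) ^ k)
  | 0, m, n, hnext => by simpa [countMistakes] using hnext m
  | k + 1, m, n, hnext => by
    have hi := integrable_noise κ hh q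
    set B := 1 + (∫ x, noise κ h x ∂q) * (A - 1) with hB
    refine Learner.failureLE_query
      (g := fun x y => b + c * A ^ (if h x = y then m else m + 1) * B ^ k)
      (G := fun x => b + c * A ^ m * B ^ k + c * A ^ m * B ^ k * (A - 1) * noise κ h x)
      (fun x y => failureLE_countMistakes hh k _ (n + 1) fun m => ?_)
      ((integrable_const _).add (hi.const_mul _)) (fun x => le_of_eq ?_) (le_of_eq ?_)
    · rw [Nat.add_right_comm]
      exact hnext m
    · have hne : h x ≠ !h x := by simp
      rw [integral_label κ h, if_pos rfl, if_neg hne]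
      ring
    · rw [integral_add_const_mul hi, pow_succ, hB]
      ring

-- Markov's inequality for `c * A ^ m`, where `m` is the number of mistakes.
lemma failureLE_countMistakes_of_lt_one (hh : Measurable h) {next : ℕ → Learner X} {c A : ℝ}
    (hb : 0 ≤ b) (hc : 0 ≤ c) (hA : 0 ≤ A) {k : ℕ}
    (hnext : ∀ m, c * A ^ m < 1 → (next m).FailureLE κ E (n + k) b) :
    (countMistakes q h next k 0).FailureLE κ E n
      (b + c * (1 + (∫ x, noise κ h x ∂q) * (A - 1)) ^ k) := by
  have hcount := failureLE_countMistakes (κ := κ) (E := E) (q := q) (next := next) (b := b)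
    (c := c) (A := A) hh k 0 n fun m => ?_
  · simpa using hcount
  · rcases lt_or_ge (c * A ^ m) 1 with hlt | hge
    · exact (hnext m hlt).mono (le_add_of_nonneg_right (by positivity))
    · exact Learner.failureLE_of_one_le (by linarith)

lemma chernoff_step {g P : ℝ} (hg : 0 ≤ g) (hP : P ≤ 1 / 2 - g) :
    1 + P * ((1 + 2 * g) ^ 2 - 1) ≤ (1 + 2 * g) * (1 - 2 * g ^ 2) :=
  calc 1 + P * ((1 + 2 * g) ^ 2 - 1) ≤ 1 + (1 / 2 - g) * ((1 + 2 * g) ^ 2 - 1) := by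
        have : 0 ≤ (1 + 2 * g) ^ 2 - 1 := by nlinarith
        gcongr
    _ = (1 + 2 * g) * (1 - 2 * g ^ 2) := by ring

variable {g : ℝ} {next : ℕ → Learner X} {k : ℕ}

lemma failureLE_countMistakes_of_small (hh : Measurable h) (hg : 0 ≤ g) (hb : 0 ≤ b)
    (hP : ∫ x, noise κ h x ∂q ≤ 1 / 2 - g)
    (hnext : ∀ m, 2 * m < k → (next m).FailureLE κ E (n + k) b) :
    (countMistakes q h next k 0).FailureLE κ E n (b + (1 - 2 * g ^ 2) ^ k) := by
  have hP0 := integral_noise_nonneg κ h q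
  have hstep := chernoff_step hg hP
  have hz : 1 ≤ 1 + 2 * g := by linarith
  set z := 1 + 2 * g
  refine (failureLE_countMistakes_of_lt_one (c := (z ^ k)⁻¹) (A := z ^ 2) hh hb (by positivity)
    (by positivity) fun m hm => hnext m (lt_of_not_ge fun hkm => ?_)).mono ?_
  · rw [← pow_mul, ← div_eq_inv_mul, div_lt_one (by positivity)] at hm
    exact hm.not_ge (pow_le_pow_right₀ hz hkm)
  · have hbase : 0 ≤ 1 + (∫ x, noise κ h x ∂q) * (z ^ 2 - 1) :=
      add_nonneg zero_le_one (mul_nonneg hP0 (sub_nonneg.2 (one_le_pow₀ hz)))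
    gcongr
    calc (z ^ k)⁻¹ * (1 + (∫ x, noise κ h x ∂q) * (z ^ 2 - 1)) ^ k
        ≤ (z ^ k)⁻¹ * (z * (1 - 2 * g ^ 2)) ^ k := by gcongr
      _ = (1 - 2 * g ^ 2) ^ k := by rw [mul_pow, inv_mul_cancel_left₀ (by positivity)]

lemma failureLE_countMistakes_of_large (hh : Measurable h) (hg : 0 ≤ g) (hb : 0 ≤ b)
    (hP : 1 / 2 + g ≤ ∫ x, noise κ h x ∂q)
    (hnext : ∀ m, k ≤ 2 * m → (next m).FailureLE κ E (n + k) b) :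
    (countMistakes q h next k 0).FailureLE κ E n (b + (1 - 2 * g ^ 2) ^ k) := by
  have hP1 := integral_noise_le_one (κ := κ) (q := q) hh
  have hstep := chernoff_step hg (P := 1 - ∫ x, noise κ h x ∂q) (by linarith)
  set P := ∫ x, noise κ h x ∂q
  have hz : 1 ≤ 1 + 2 * g := by linarith
  set z := 1 + 2 * g
  refine (failureLE_countMistakes_of_lt_one (c := z ^ k) (A := (z ^ 2)⁻¹) hh hb (by positivity)
    (by positivity) fun m hm => hnext m (le_of_not_gt fun hkm => ?_)).mono ?_
  · rw [inv_pow, ← pow_mul, ← div_eq_mul_inv, div_lt_one (by positivity)] at hm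
    exact hm.not_ge (pow_le_pow_right₀ hz hkm.le)
  · have hbase : z * (1 + P * ((z ^ 2)⁻¹ - 1)) = (1 + (1 - P) * (z ^ 2 - 1)) / z := by
      field_simp
      ring
    have hbase0 : 0 ≤ z * (1 + P * ((z ^ 2)⁻¹ - 1)) := by
      rw [hbase]
      have := mul_nonneg (sub_nonneg.2 hP1) (sub_nonneg.2 (one_le_pow₀ (n := 2) hz))
      positivity
    gcongr
    calc z ^ k * (1 + P * ((z ^ 2)⁻¹ - 1)) ^ k = (z * (1 + P * ((z ^ 2)⁻¹ - 1))) ^ k :=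
          (mul_pow _ _ _).symm
      _ ≤ (1 - 2 * g ^ 2) ^ k := by
          refine pow_le_pow_left₀ hbase0 ?_ k
          rwa [hbase, div_le_iff₀' (by positivity)]

end Learners

/-! ### The second stage -/

section StageTwo

variable {X : Type*} [MeasurableSpace X] {D : Measure X} {κ : Kernel X Bool} [IsMarkovKernel κ]
  {h h₁ h₂ c : X → Bool} {g T : ℝ}

lemma noise_add_noise (κ : Kernel X Bool) [IsMarkovKernel κ] {x : X} (hx : h₁ x ≠ h₂ x) :
    noise κ h₁ x + noise κ h₂ x = 1 := by
  have hcompl : {y | h₂ x ≠ y} = {y | h₁ x ≠ y}ᶜ := by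
    ext y
    revert hx
    cases h₁ x <;> cases h₂ x <;> cases y <;> simp
  rw [noise, noise, hcompl, measureReal_add_measureReal_compl (Set.toFinite _).measurableSet,
    probReal_univ]

variable [IsFiniteMeasure D]

lemma integral_noise_cond_le (hh : Measurable h) {A : Set X} {t : ℝ} (hT : 0 ≤ T) (ht : 0 ≤ t)
    (herr : err D κ h ≤ t * T) (hA : T < D.real A) : ∫ x, noise κ h x ∂(cond D A) ≤ t := by
  rw [integral_cond, inv_mul_le_iff₀ (hT.trans_lt hA)]
  calc ∫ x in A, noise κ h x ∂D ≤ ∫ x, noise κ h x ∂D :=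
        setIntegral_le_integral (integrable_noise κ hh D) (.of_forall (noise_nonneg κ h))
    _ = err D κ h := (err_eq_integral_noise κ hh).symm
    _ ≤ t * T := herr
    _ ≤ t * D.real A := mul_le_mul_of_nonneg_left hA.le ht
    _ = D.real A * t := mul_comm _ _

lemma isProbabilityMeasure_cond_ne (h0 : 0 < hdist D h₁ h₂) :
    IsProbabilityMeasure (cond D {x | h₁ x ≠ h₂ x}) :=
  cond_isProbabilityMeasure fun hnull => h0.ne' (by rw [hdist, measureReal_def, hnull]; rfl)

lemma integral_noise_cond_ne (hh₁ : Measurable h₁) (hh₂ : Measurable h₂)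
    (h0 : 0 < hdist D h₁ h₂) :
    ∫ x, noise κ h₁ x ∂(cond D {x | h₁ x ≠ h₂ x}) =
      1 - ∫ x, noise κ h₂ x ∂(cond D {x | h₁ x ≠ h₂ x}) := by
  have := isProbabilityMeasure_cond_ne h0
  rw [← integral_one_sub (integrable_noise κ hh₂ _)]
  refine integral_congr_ae ?_
  filter_upwards [ae_cond_mem (μ := D) (measurableSet_ne hh₁ hh₂)] with x hx
  exact eq_sub_of_add_eq (noise_add_noise κ hx)

variable {E : (X → Bool) → ℕ → Prop} {n k : ℕ} {b : ℝ}

lemma failureLE_comparison (hh₁ : Measurable h₁) (hh₂ : Measurable h₂) (hT : 0 ≤ T) (hg : 0 ≤ g)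
    (hg2 : g ≤ 1 / 2) (hc : err D κ c ≤ (1 / 2 - g) * T) (hfar : T < hdist D h₁ h₂) (hb : 0 ≤ b)
    {next : (X → Bool) → Learner X}
    (hnext : ∀ h, h = h₁ ∨ h = h₂ → h ≠ c → (next h).FailureLE κ E (n + k) b) :
    (countMistakes (cond D {x | h₁ x ≠ h₂ x}) h₁
      (fun m => next (if k ≤ 2 * m then h₁ else h₂)) k 0).FailureLE κ E n
        (b + (1 - 2 * g ^ 2) ^ k) := by
  have hd : 0 < hdist D h₁ h₂ := hT.trans_lt hfar
  have := isProbabilityMeasure_cond_ne hd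
  have hne : h₁ ≠ h₂ := by
    rintro rfl
    exact hd.ne' (hdist_self D h₁)
  have ht : 0 ≤ 1 / 2 - g := sub_nonneg.2 hg2
  by_cases hc₁ : c = h₁
  · refine failureLE_countMistakes_of_small hh₁ hg hb
      (integral_noise_cond_le hh₁ hT ht (hc₁ ▸ hc) hfar) fun m hm => ?_
    rw [if_neg hm.not_ge]
    exact hnext h₂ (.inr rfl) (hc₁ ▸ hne.symm)
  by_cases hc₂ : c = h₂
  · refine failureLE_countMistakes_of_large hh₁ hg hb ?_ fun m hm => ?_
    · rw [integral_noise_cond_ne hh₁ hh₂ hd]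
      linarith [integral_noise_cond_le hh₂ hT ht (hc₂ ▸ hc) hfar]
    · rw [if_pos hm]
      exact hnext h₁ (.inl rfl) (hc₂ ▸ hne)
  · have hcount := failureLE_countMistakes (κ := κ) (E := E) (q := cond D {x | h₁ x ≠ h₂ x})
      (b := b) (c := 0) (A := 0) hh₁ (next := fun m => next (if k ≤ 2 * m then h₁ else h₂)) k 0 n
      fun m => by
        rw [zero_mul, add_zero]
        split_ifs
        · exact hnext h₁ (.inl rfl) (Ne.symm hc₁)
        · exact hnext h₂ (.inr rfl) (Ne.symm hc₂)
    refine hcount.mono ?_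
    have : 0 ≤ (1 - 2 * g ^ 2) ^ k := pow_nonneg (by nlinarith) k
    simpa using this

-- A candidate `c` of small error rarely loses a comparison, and once all candidates are within `T`
-- of each other, any of them is within `T` of `c`.
lemma failureLE_stageTwo {H : Set (X → Bool)} {η R a : ℝ} (ch : Choices D H η R a T) (hT : 0 ≤ T)
    (hg : 0 ≤ g) (hg2 : g ≤ 1 / 2) (hc : err D κ c ≤ (1 / 2 - g) * T) :
    ∀ (j : ℕ) (C : Finset (X → Bool)) (n : ℕ), (∀ h ∈ C, Measurable h) → c ∈ C → C.card ≤ j →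
      (∀ h ∈ C, hdist D c h ≤ T → ∀ m ≤ n + j * k, E h m) →
      (stageTwo ch k j C).FailureLE κ E n (j * (1 - 2 * g ^ 2) ^ k)
  | 0, C, n, _, hcC, hcard, _ => by
    have := Finset.card_pos.2 ⟨c, hcC⟩
    omega
  | j + 1, C, n, hmeas, hcC, hcard, hE => by
    classical
    have hρ : 0 ≤ (1 - 2 * g ^ 2) ^ k := pow_nonneg (by nlinarith) k
    rw [stageTwo]
    split_ifs with hfar
    · obtain ⟨h₁C, h₂C, hlt⟩ := ch.pair_spec C hfar
      have hcmp := failureLE_comparison (n := n) (k := k) (hmeas _ h₁C) (hmeas _ h₂C) hT hg hg2 hc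
        hlt (mul_nonneg j.cast_nonneg hρ) (E := E) (next := fun h => stageTwo ch k j (C.erase h))
        fun h hh hne => ?_
      · refine hcmp.mono (le_of_eq ?_)
        push_cast
        ring
      have hhC : h ∈ C := by rcases hh with rfl | rfl <;> assumption
      refine failureLE_stageTwo ch hT hg hg2 hc j _ (n + k)
        (fun h hh => hmeas h (Finset.mem_of_mem_erase hh)) (Finset.mem_erase.2 ⟨hne.symm, hcC⟩)
        (by rw [Finset.card_erase_of_mem hhC]; omega) fun h hh hch m hm => ?_
      exact hE h (Finset.mem_of_mem_erase hh) hch m (hm.trans_eq (by ring))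
    · push Not at hfar
      have hpick := ch.pick_mem C ⟨c, hcC⟩
      exact Learner.failureLE_output
        (hE _ hpick (hfar c hcC _ hpick) n (Nat.le_add_right _ _)) (by positivity)

end StageTwo

/-! ### Capped distributions -/

section Capped

variable {X : Type*} {F S : Finset (X → Bool)} {lam : (X → Bool) → ℝ}

open Classical in
lemma sum_capped (h1 : ∑ h ∈ S, lam h ≠ 1) (G : Finset (X → Bool)) :
    ∑ h ∈ G, capped lam S h =
      1 / 2 * ∑ h ∈ G, lam h + 1 / 2 * ((∑ h ∈ G \ S, lam h) / (1 - ∑ h ∈ S, lam h)) := by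
  have hfree : 1 - ∑ h ∈ S, lam h ≠ 0 := sub_ne_zero.2 h1.symm
  have hcapped (h : X → Bool) : capped lam S h =
      1 / 2 * lam h + 1 / 2 * ((if h ∉ S then lam h else 0) / (1 - ∑ h ∈ S, lam h)) := by
    by_cases hh : h ∈ S
    · simp [capped, hh]
    · rw [capped, if_neg hh, if_pos hh]
      field_simp
      ring
  simp only [hcapped]
  rw [Finset.sum_add_distrib, ← Finset.mul_sum, ← Finset.mul_sum, ← Finset.sum_div,
    ← Finset.sum_filter, Finset.sdiff_eq_filter]

lemma IsDistribution.capped (hlam : IsDistribution F lam) (hS : S ⊆ F)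
    (h1 : ∑ h ∈ S, lam h < 1) : IsDistribution F (capped lam S) := by
  classical
  have hS0 : 0 ≤ ∑ h ∈ S, lam h := Finset.sum_nonneg fun h hh => hlam.1 h (hS hh)
  refine ⟨fun h hh => ?_, ?_⟩
  · rw [ActiveLearning.capped]
    have := hlam.1 h hh
    split_ifs
    · positivity
    · exact mul_nonneg this (div_nonneg (by linarith [hS0]) (by linarith))
  · rw [sum_capped h1.ne, Finset.sum_sdiff_eq_sub hS, hlam.2, div_self (sub_pos.2 h1).ne']
    norm_num

/-- The mass of the hypotheses that disagree with `t` at `x`: if `t x` is the label of `x`, these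
are the hypotheses that are penalized. -/
def disagreement (F : Finset (X → Bool)) (lam : (X → Bool) → ℝ) (t : X → Bool) (x : X) : ℝ :=
  ∑ h ∈ F with h x ≠ t x, lam h

lemma IsDistribution.disagreement_nonneg (hlam : IsDistribution F lam) (t : X → Bool) (x : X) :
    0 ≤ disagreement F lam t x :=
  Finset.sum_nonneg fun h hh => hlam.1 h (Finset.mem_filter.1 hh).1

lemma IsDistribution.disagreement_le_one (hlam : IsDistribution F lam) (t : X → Bool) (x : X) :
    disagreement F lam t x ≤ 1 :=
  (Finset.sum_le_sum_of_subset_of_nonneg (Finset.filter_subset _ F)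
    fun h hh _ => hlam.1 h hh).trans_eq hlam.2

lemma IsDistribution.minority_le_disagreement (hlam : IsDistribution F lam) (t : X → Bool)
    (x : X) : minority F lam x ≤ disagreement F lam t x := by
  have hsplit := Finset.sum_filter_add_sum_filter_not F (fun h => h x = true) lam
  rw [hlam.2] at hsplit
  rw [minority, disagreement]
  cases t x
  · exact (min_le_left _ _).trans_eq (by simp)
  · exact (min_le_right _ _).trans_eq (sub_eq_of_eq_add' hsplit.symm)

lemma IsDistribution.minority_nonneg (hlam : IsDistribution F lam) (x : X) :
    0 ≤ minority F lam x := by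
  refine le_min (Finset.sum_nonneg fun h hh => hlam.1 h (Finset.mem_filter.1 hh).1) ?_
  rw [sub_nonneg, ← hlam.2]
  exact Finset.sum_le_sum_of_subset_of_nonneg (Finset.filter_subset _ F) fun h hh _ => hlam.1 h hh

variable [MeasurableSpace X] {D q : Measure X} {κ : Kernel X Bool} [IsMarkovKernel κ]
  {t : X → Bool}

lemma IsDistribution.integrable_disagreement (hlam : IsDistribution F lam)
    (hF : ∀ h ∈ F, Measurable h) (ht : Measurable t) (q : Measure X) [IsFiniteMeasure q] :
    Integrable (disagreement F lam t) q :=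
  Integrable.of_mem_Icc 0 1
    (measurable_sum_filter (fun h hh => measurableSet_ne (hF h hh) ht) lam).aemeasurable
    (.of_forall fun x => ⟨hlam.disagreement_nonneg t x, hlam.disagreement_le_one t x⟩)

lemma IsDistribution.integrable_minority (hlam : IsDistribution F lam)
    (hF : ∀ h ∈ F, Measurable h) (q : Measure X) [IsFiniteMeasure q] :
    Integrable (minority F lam) q :=
  Integrable.of_mem_Icc 0 1 (measurable_minority hF lam).aemeasurable
    (.of_forall fun x => ⟨hlam.minority_nonneg x,
      (hlam.minority_le_disagreement (fun _ => true) x).trans (hlam.disagreement_le_one _ x)⟩)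

-- The penalty for the maximal density pays for the noise that the query distribution may see.
lemma IsDistribution.queryValue_minority_le [IsFiniteMeasure D] (hlam : IsDistribution F lam)
    (hF : ∀ h ∈ F, Measurable h) (ht : Measurable t) (hq : IsQueryDist D q) {a b : ℝ} (hb : 0 ≤ b)
    (herr : b * err D κ t ≤ a) :
    queryValue D a (minority F lam) q ≤ ∫ x, (disagreement F lam t x - b * noise κ t x) ∂q := by
  have := hq.1
  have hnoise : b * ∫ x, noise κ t x ∂q ≤ a * maxRatio D q :=
    calc b * ∫ x, noise κ t x ∂q ≤ b * (maxRatio D q * err D κ t) := by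
          rw [err_eq_integral_noise κ ht]
          exact mul_le_mul_of_nonneg_left
            (hq.integral_le (noise_nonneg κ t) (integrable_noise κ ht D)) hb
      _ = b * err D κ t * maxRatio D q := by ring
      _ ≤ a * maxRatio D q := mul_le_mul_of_nonneg_right herr ENNReal.toReal_nonneg
  rw [integral_sub (hlam.integrable_disagreement hF ht q)
    ((integrable_noise κ ht q).const_mul b), integral_const_mul]
  exact sub_le_sub (integral_mono (hlam.integrable_minority hF q)
    (hlam.integrable_disagreement hF ht q) (hlam.minority_le_disagreement t)) hnoise

end Capped

/-! ### The potential of a hypothesis -/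

section Weights

variable {X : Type*} {F S G : Finset (X → Bool)} {w : (X → Bool) → ℝ} {t : X → Bool}

open Classical in
/-- The weight of the members of `G` that are not capped. -/
noncomputable def freeWeight (w : (X → Bool) → ℝ) (S G : Finset (X → Bool)) : ℝ :=
  ∑ h ∈ G \ S, w h

/-- The potential `1 / (λ(t) · λ(t | Sᶜ))` of the hypothesis `t`, where `λ` is the distribution on
`F` with weights `w` and `S` is the capped set. The first stage makes it decrease. -/
noncomputable def potential (F : Finset (X → Bool)) (w : (X → Bool) → ℝ) (S : Finset (X → Bool))
    (t : X → Bool) : ℝ :=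
  (∑ h ∈ F, w h) * freeWeight w S F / w t ^ 2

lemma nonempty_of_ssubset (hS : S ⊂ F) : F.Nonempty :=
  (Finset.exists_of_ssubset hS).imp fun _ => And.left

lemma freeWeight_pos (hw : ∀ h ∈ F, 0 < w h) (hS : S ⊂ F) : 0 < freeWeight w S F := by
  classical
  exact Finset.sum_pos (fun h hh => hw h (Finset.sdiff_subset hh))
    (Finset.sdiff_nonempty.2 hS.not_subset)

lemma sum_weights_pos (hw : ∀ h ∈ F, 0 < w h) (hS : S ⊂ F) : 0 < ∑ h ∈ F, w h :=
  Finset.sum_pos hw (nonempty_of_ssubset hS)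

lemma sum_weights_mono (hw : ∀ h ∈ F, 0 < w h) (hG : G ⊆ F) :
    ∑ h ∈ G, w h ≤ ∑ h ∈ F, w h :=
  Finset.sum_le_sum_of_subset_of_nonneg hG fun h hh _ => (hw h hh).le

lemma freeWeight_mono (hw : ∀ h ∈ F, 0 < w h) (hG : G ⊆ F) :
    freeWeight w S G ≤ freeWeight w S F := by
  classical
  exact sum_weights_mono (fun h hh => hw h (Finset.sdiff_subset hh))
    (Finset.sdiff_subset_sdiff hG subset_rfl)

lemma potential_one (F : Finset (X → Bool)) (t : X → Bool) :
    potential F (fun _ => 1) ∅ t = (F.card : ℝ) ^ 2 := by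
  simp [potential, freeWeight, sq]

lemma potential_pos (hw : ∀ h ∈ F, 0 < w h) (hS : S ⊂ F) (ht : t ∈ F) :
    0 < potential F w S t :=
  div_pos (mul_pos (sum_weights_pos hw hS) (freeWeight_pos hw hS)) (pow_pos (hw t ht) 2)

lemma one_le_potential (hw : ∀ h ∈ F, 0 < w h) (ht : t ∈ F) (htS : t ∉ S) :
    1 ≤ potential F w S t := by
  classical
  have hfree : w t ≤ freeWeight w S F :=
    Finset.single_le_sum (fun h hh => (hw h (Finset.sdiff_subset hh)).le)
      (Finset.mem_sdiff.2 ⟨ht, htS⟩)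
  have htotal : w t ≤ ∑ h ∈ F, w h := Finset.single_le_sum (fun h hh => (hw h hh).le) ht
  have ht0 := (hw t ht).le
  rw [potential, one_le_div (pow_pos (hw t ht) 2), sq]
  exact mul_le_mul htotal hfree ht0 (ht0.trans htotal)

lemma isDistribution_posterior (hw : ∀ h ∈ F, 0 < w h) (hF : F.Nonempty) :
    IsDistribution F (posterior F w) := by
  have hW := Finset.sum_pos hw hF
  refine ⟨fun h hh => div_nonneg (hw h hh).le hW.le, ?_⟩
  simp only [posterior]
  rw [← Finset.sum_div, div_self hW.ne']

lemma one_sub_sum_posterior (hw : ∀ h ∈ F, 0 < w h) (hS : S ⊂ F) :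
    1 - ∑ h ∈ S, posterior F w h = freeWeight w S F / ∑ h ∈ F, w h := by
  classical
  simp only [posterior]
  rw [← Finset.sum_div, eq_div_iff (sum_weights_pos hw hS).ne', sub_mul, one_mul,
    div_mul_cancel₀ _ (sum_weights_pos hw hS).ne', freeWeight, Finset.sum_sdiff_eq_sub hS.subset]

lemma sum_posterior_lt_one (hw : ∀ h ∈ F, 0 < w h) (hS : S ⊂ F) :
    ∑ h ∈ S, posterior F w h < 1 := by
  rw [← sub_pos, one_sub_sum_posterior hw hS]
  exact div_pos (freeWeight_pos hw hS) (sum_weights_pos hw hS)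

lemma isDistribution_capped_posterior (hw : ∀ h ∈ F, 0 < w h) (hS : S ⊂ F) :
    IsDistribution F (capped (posterior F w) S) :=
  (isDistribution_posterior hw (nonempty_of_ssubset hS)).capped hS.subset
    (sum_posterior_lt_one hw hS)

-- Capping averages the distribution with its restriction to the complement of `S`.
lemma sum_capped_posterior (hw : ∀ h ∈ F, 0 < w h) (hS : S ⊂ F) (G : Finset (X → Bool)) :
    ∑ h ∈ G, capped (posterior F w) S h =
      ((∑ h ∈ G, w h) / ∑ h ∈ F, w h + freeWeight w S G / freeWeight w S F) / 2 := by
  classical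
  rw [sum_capped (sum_posterior_lt_one hw hS).ne, one_sub_sum_posterior hw hS]
  simp only [posterior]
  rw [← Finset.sum_div, ← Finset.sum_div, ← freeWeight,
    div_div_div_cancel_right₀ (sum_weights_pos hw hS).ne']
  ring

lemma weight_of_heavy (hw : ∀ h ∈ F, 0 < w h) (hS : S ⊂ F) (hG : G ⊆ F)
    (hheavy : 4 / 5 < ∑ h ∈ G, capped (posterior F w) S h) :
    3 / 5 * ∑ h ∈ F, w h < ∑ h ∈ G, w h ∧ 3 / 5 * freeWeight w S F < freeWeight w S G := by
  have hW := sum_weights_pos hw hS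
  have hV := freeWeight_pos hw hS
  rw [sum_capped_posterior hw hS] at hheavy
  have htotal : (∑ h ∈ G, w h) / ∑ h ∈ F, w h ≤ 1 := (div_le_one hW).2 (sum_weights_mono hw hG)
  have hfree : freeWeight w S G / freeWeight w S F ≤ 1 :=
    (div_le_one hV).2 (freeWeight_mono hw hG)
  exact ⟨(lt_div_iff₀ hW).1 (by linarith), (lt_div_iff₀ hV).1 (by linarith)⟩

lemma exists_mem_inter_of_heavy {G' : Finset (X → Bool)} (hw : ∀ h ∈ F, 0 < w h) (hG : G ⊆ F)
    (hG' : G' ⊆ F) (hheavy : 3 / 5 * ∑ h ∈ F, w h < ∑ h ∈ G, w h)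
    (hheavy' : 3 / 5 * ∑ h ∈ F, w h < ∑ h ∈ G', w h) : ∃ h ∈ G, h ∈ G' := by
  classical
  by_contra! hdisj
  have hunion := sum_weights_mono hw (Finset.union_subset hG hG')
  rw [Finset.sum_union (Finset.disjoint_left.2 hdisj)] at hunion
  have hW : 0 ≤ ∑ h ∈ F, w h := Finset.sum_nonneg fun h hh => (hw h hh).le
  linarith

lemma potential_le_of_heavy {S' : Finset (X → Bool)} (hw : ∀ h ∈ F, 0 < w h) (hS : S ⊂ F)
    (hG : G ⊆ F) (hheavy : 4 / 5 < ∑ h ∈ G, capped (posterior F w) S h) (hSS' : S ⊆ S')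
    (hGS' : G ⊆ S') : potential F w S' t ≤ 2 / 5 * potential F w S t := by
  classical
  have hdisj : Disjoint (F \ S') (G \ S) :=
    Finset.sdiff_disjoint.mono_right (Finset.sdiff_subset.trans hGS')
  have hsum : freeWeight w S' F + freeWeight w S G ≤ freeWeight w S F := by
    rw [freeWeight, freeWeight, ← Finset.sum_union hdisj]
    exact sum_weights_mono (fun h hh => hw h (Finset.sdiff_subset hh))
      (Finset.union_subset (Finset.sdiff_subset_sdiff subset_rfl hSS')
        (Finset.sdiff_subset_sdiff hG subset_rfl))
  have hfree : freeWeight w S' F ≤ 2 / 5 * freeWeight w S F := by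
    linarith [(weight_of_heavy hw hS hG hheavy).2]
  calc potential F w S' t ≤ (∑ h ∈ F, w h) * (2 / 5 * freeWeight w S F) / w t ^ 2 :=
        div_le_div_of_nonneg_right
          (mul_le_mul_of_nonneg_left hfree (sum_weights_pos hw hS).le) (sq_nonneg _)
    _ = 2 / 5 * potential F w S t := by rw [potential]; ring

end Weights

/-! ### The multiplicative update -/

section Update

variable {X : Type*} {F S G : Finset (X → Bool)} {w : (X → Bool) → ℝ} {t : X → Bool} {α : ℝ}

lemma nextW_pos (hw : ∀ h ∈ F, 0 < w h) (x : X) (y : Bool) :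
    ∀ h ∈ F, 0 < nextW F α w x y h := by
  intro h hh
  have := hw h hh
  rw [nextW]
  split_ifs <;> positivity

lemma sum_nextW (hG : G ⊆ F) (x : X) (y : Bool) :
    ∑ h ∈ G, nextW F α w x y h =
      ∑ h ∈ G, w h - (1 - Real.exp (-α)) * ∑ h ∈ G with h x ≠ y, w h := by
  rw [Finset.sum_filter, Finset.mul_sum, ← Finset.sum_sub_distrib]
  refine Finset.sum_congr rfl fun h hh => ?_
  rw [nextW]
  by_cases hy : h x = y
  · simp [hy]
  · rw [if_pos ⟨hG hh, hy⟩, if_pos hy]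
    ring

open Classical in
lemma freeWeight_filter (w : (X → Bool) → ℝ) (S F : Finset (X → Bool)) (p : (X → Bool) → Prop)
    [DecidablePred p] : freeWeight w S (F.filter p) = ∑ h ∈ F \ S with p h, w h := by
  rw [freeWeight]
  congr 1
  ext h
  simp only [Finset.mem_filter, Finset.mem_sdiff, and_right_comm]

lemma freeWeight_nextW (x : X) (y : Bool) :
    freeWeight (nextW F α w x y) S F =
      freeWeight w S F - (1 - Real.exp (-α)) * freeWeight w S {h ∈ F | h x ≠ y} := by
  classical
  rw [freeWeight, sum_nextW Finset.sdiff_subset, freeWeight_filter, freeWeight]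

lemma sum_filter_ne_not (f : (X → Bool) → ℝ) (G : Finset (X → Bool)) (x : X) (y : Bool) :
    ∑ h ∈ G with h x ≠ !y, f h = ∑ h ∈ G, f h - ∑ h ∈ G with h x ≠ y, f h := by
  rw [eq_sub_iff_add_eq, ← Finset.sum_filter_add_sum_filter_not G (fun h => h x = y) f]
  simp only [ne_eq, Bool.not_eq_not]

lemma freeWeight_filter_ne_not (x : X) (y : Bool) :
    freeWeight w S {h ∈ F | h x ≠ !y} =
      freeWeight w S F - freeWeight w S {h ∈ F | h x ≠ y} := by
  classical
  rw [freeWeight_filter, freeWeight_filter, sum_filter_ne_not, freeWeight]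

-- Both factors interpolate between `c` and `c + d`, and `z ↦ z ^ 2` lies below its chord.
lemma interpolate_mul_interpolate_le (c d : ℝ) {u v s : ℝ} (hs : s = (u + v) / 2) (hs0 : 0 ≤ s)
    (hs1 : s ≤ 1) : (c + d * u) * (c + d * v) ≤ (1 - s) * c ^ 2 + s * (c + d) ^ 2 :=
  calc (c + d * u) * (c + d * v) ≤ (c + d * s) ^ 2 := by
        subst hs
        linarith [mul_nonneg (sq_nonneg d) (sq_nonneg (u - v))]
    _ ≤ (1 - s) * c ^ 2 + s * (c + d) ^ 2 := by
        linarith [mul_nonneg (mul_nonneg hs0 (sub_nonneg.2 hs1)) (sq_nonneg d)]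

lemma disagreement_capped_posterior (hw : ∀ h ∈ F, 0 < w h) (hS : S ⊂ F) (x : X) :
    disagreement F (capped (posterior F w) S) t x =
      ((∑ h ∈ F with h x ≠ t x, w h) / ∑ h ∈ F, w h +
        freeWeight w S {h ∈ F | h x ≠ t x} / freeWeight w S F) / 2 :=
  sum_capped_posterior hw hS _

lemma potential_nextW_self_le (hw : ∀ h ∈ F, 0 < w h) (hS : S ⊂ F) (ht : t ∈ F) (x : X) :
    potential F (nextW F α w x (t x)) S t ≤ potential F w S t *
      (1 - (1 - Real.exp (-α) ^ 2) * disagreement F (capped (posterior F w) S) t x) := by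
  have hW := sum_weights_pos hw hS
  have hV := freeWeight_pos hw hS
  have hcap := isDistribution_capped_posterior hw hS
  have hkeep : nextW F α w x (t x) t = w t := by simp [nextW]
  calc potential F (nextW F α w x (t x)) S t
      = potential F w S t *
          ((1 + (Real.exp (-α) - 1) * ((∑ h ∈ F with h x ≠ t x, w h) / ∑ h ∈ F, w h)) *
            (1 + (Real.exp (-α) - 1) *
              (freeWeight w S {h ∈ F | h x ≠ t x} / freeWeight w S F))) := by
        rw [potential, sum_nextW subset_rfl, freeWeight_nextW, hkeep, potential]
        field_simp
        ring
    _ ≤ potential F w S t *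
          (1 - (1 - Real.exp (-α) ^ 2) * disagreement F (capped (posterior F w) S) t x) := by
        refine mul_le_mul_of_nonneg_left ?_ (potential_pos hw hS ht).le
        refine (interpolate_mul_interpolate_le 1 (Real.exp (-α) - 1)
          (disagreement_capped_posterior hw hS x) (hcap.disagreement_nonneg t x)
          (hcap.disagreement_le_one t x)).trans_eq ?_
        ring

lemma potential_nextW_not_le (hw : ∀ h ∈ F, 0 < w h) (hS : S ⊂ F) (ht : t ∈ F) (x : X) :
    potential F (nextW F α w x (!t x)) S t ≤ potential F w S t *
      (1 + (Real.exp α ^ 2 - 1) * disagreement F (capped (posterior F w) S) t x) := by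
  have hW := sum_weights_pos hw hS
  have hV := freeWeight_pos hw hS
  have hcap := isDistribution_capped_posterior hw hS
  have hkeep : nextW F α w x (!t x) t = Real.exp (-α) * w t := by simp [nextW, ht]
  calc potential F (nextW F α w x (!t x)) S t
      = potential F w S t *
          ((1 + (Real.exp α - 1) * ((∑ h ∈ F with h x ≠ t x, w h) / ∑ h ∈ F, w h)) *
            (1 + (Real.exp α - 1) *
              (freeWeight w S {h ∈ F | h x ≠ t x} / freeWeight w S F))) := by
        rw [potential, sum_nextW subset_rfl, freeWeight_nextW, hkeep, potential,
          sum_filter_ne_not, freeWeight_filter_ne_not, Real.exp_neg]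
        field_simp
        ring
    _ ≤ potential F w S t *
          (1 + (Real.exp α ^ 2 - 1) * disagreement F (capped (posterior F w) S) t x) := by
        refine mul_le_mul_of_nonneg_left ?_ (potential_pos hw hS ht).le
        refine (interpolate_mul_interpolate_le 1 (Real.exp α - 1)
          (disagreement_capped_posterior hw hS x) (hcap.disagreement_nonneg t x)
          (hcap.disagreement_le_one t x)).trans_eq ?_
        ring

variable [MeasurableSpace X]

lemma integral_potential_nextW_le (κ : Kernel X Bool) [IsMarkovKernel κ] (hα : 0 ≤ α)
    (hw : ∀ h ∈ F, 0 < w h) (hS : S ⊂ F) (ht : t ∈ F) (x : X) :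
    ∫ y, potential F (nextW F α w x y) S t ∂κ x ≤ potential F w S t *
      (1 - (1 - Real.exp (-(2 * α))) * (disagreement F (capped (posterior F w) S) t x -
        (1 + Real.exp (2 * α)) * noise κ t x)) := by
  set s := disagreement F (capped (posterior F w) S) t x
  have hs1 : s ≤ 1 := (isDistribution_capped_posterior hw hS).disagreement_le_one t x
  have hexp : Real.exp (-(2 * α)) * Real.exp (2 * α) = 1 := by rw [← Real.exp_add]; simp
  have hneg : Real.exp (-α) ^ 2 = Real.exp (-(2 * α)) := by rw [← Real.exp_nat_mul]; simp
  have hpos : Real.exp α ^ 2 = Real.exp (2 * α) := by rw [← Real.exp_nat_mul]; simp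
  have hfactor : Real.exp (2 * α) - Real.exp (-(2 * α)) =
      (1 - Real.exp (-(2 * α))) * (1 + Real.exp (2 * α)) := by linear_combination hexp
  have hagree := potential_nextW_self_le (α := α) hw hS ht x
  have hdisagree := potential_nextW_not_le (α := α) hw hS ht x
  rw [hneg] at hagree
  rw [hpos] at hdisagree
  have hgap : 0 ≤ Real.exp (2 * α) - Real.exp (-(2 * α)) :=
    sub_nonneg.2 (Real.exp_le_exp.2 (by linarith))
  calc ∫ y, potential F (nextW F α w x y) S t ∂κ x
      ≤ (1 - noise κ t x) * (potential F w S t * (1 - (1 - Real.exp (-(2 * α))) * s)) +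
          noise κ t x * (potential F w S t * (1 + (Real.exp (2 * α) - 1) * s)) := by
        rw [integral_label κ t]
        exact add_le_add
          (mul_le_mul_of_nonneg_left hagree (sub_nonneg.2 (noise_le_one κ t x)))
          (mul_le_mul_of_nonneg_left hdisagree (noise_nonneg κ t x))
    _ = potential F w S t * (1 - (1 - Real.exp (-(2 * α))) * s +
          (Real.exp (2 * α) - Real.exp (-(2 * α))) * noise κ t x * s) := by ring
    _ ≤ potential F w S t * (1 - (1 - Real.exp (-(2 * α))) * s +
          (Real.exp (2 * α) - Real.exp (-(2 * α))) * noise κ t x) :=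
        mul_le_mul_of_nonneg_left (add_le_add_right (mul_le_of_le_one_right
          (mul_nonneg hgap (noise_nonneg κ t x)) hs1) _) (potential_pos hw hS ht).le
    _ = potential F w S t * (1 - (1 - Real.exp (-(2 * α))) *
          (s - (1 + Real.exp (2 * α)) * noise κ t x)) := by rw [hfactor]; ring

end Update

/-! ### One round of the first stage -/

section Round

variable {X : Type*} [MeasurableSpace X] {D : Measure X} {H : Set (X → Bool)} {η R a T : ℝ}
  {ch : Choices D H η R a T} {cap : ℕ} {w : (X → Bool) → ℝ} {S C : Finset (X → Bool)}
  {t : X → Bool}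

/-- Some ball of radius `R` has more than `80%` under the capped distribution: the test at the
beginning of a round is positive. -/
def HeavyBall (ch : Choices D H η R a T) (w : (X → Bool) → ℝ) (S : Finset (X → Bool)) : Prop :=
  ∃ μ ∈ H, 4 / 5 < ballMass D ch.packing (capped (posterior ch.packing w) S) μ R

open Classical in
lemma HeavyBall.nextS_eq (h : HeavyBall ch w S) :
    nextS ch w S = S ∪ ball D ch.packing (ch.center w) (3 * R) :=
  if_pos h

lemma nextS_eq_of_not_heavyBall (h : ¬ HeavyBall ch w S) : nextS ch w S = S :=
  if_neg h

open Classical in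
lemma HeavyBall.nextC_eq (h : HeavyBall ch w S) (hcard : C.card < cap) :
    nextC ch cap w S C = insert (ch.center w) C :=
  if_pos ⟨h, hcard⟩

lemma nextC_eq_of_not_heavyBall (h : ¬ HeavyBall ch w S) : nextC ch cap w S C = C :=
  if_neg fun h' => h h'.1

lemma subset_nextS (ch : Choices D H η R a T) (w : (X → Bool) → ℝ) (S : Finset (X → Bool)) :
    S ⊆ nextS ch w S := by
  classical
  by_cases h : HeavyBall ch w S
  · exact h.nextS_eq ▸ Finset.subset_union_left
  · exact (nextS_eq_of_not_heavyBall h).superset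

lemma nextS_subset (w : (X → Bool) → ℝ) (hS : S ⊆ ch.packing) : nextS ch w S ⊆ ch.packing := by
  classical
  by_cases h : HeavyBall ch w S
  · exact h.nextS_eq ▸ Finset.union_subset hS (ball_subset ..)
  · exact (nextS_eq_of_not_heavyBall h).trans_subset hS

lemma subset_nextC (ch : Choices D H η R a T) (cap : ℕ) (w : (X → Bool) → ℝ)
    (S C : Finset (X → Bool)) : C ⊆ nextC ch cap w S C := by
  classical
  rw [nextC]
  split_ifs
  · exact Finset.subset_insert _ _
  · exact subset_rfl

lemma nextC_subset (cap : ℕ) (w : (X → Bool) → ℝ) (S : Finset (X → Bool))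
    (hC : (↑C : Set (X → Bool)) ⊆ H) : (↑(nextC ch cap w S C) : Set (X → Bool)) ⊆ H := by
  classical
  rw [nextC]
  split_ifs
  · exact Finset.coe_insert (ch.center w) C ▸ Set.insert_subset (ch.center_mem w) hC
  · exact hC

lemma card_nextC_le (w : (X → Bool) → ℝ) (S : Finset (X → Bool)) (hC : C.card ≤ cap) :
    (nextC ch cap w S C).card ≤ cap := by
  classical
  rw [nextC]
  split_ifs with h
  · exact (Finset.card_insert_le _ _).trans h.2
  · exact hC

/-- The invariant of the first stage on the weights `w`, the capped set `S` and the centers `C`. -/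
structure ValidState (ch : Choices D H η R a T) (cap : ℕ) (w : (X → Bool) → ℝ)
    (S C : Finset (X → Bool)) : Prop where
  weight_pos : ∀ h ∈ ch.packing, 0 < w h
  capped_subset : S ⊆ ch.packing
  centers_subset : (↑C : Set (X → Bool)) ⊆ H
  card_centers_le : C.card ≤ cap

lemma validState_init (ch : Choices D H η R a T) (cap : ℕ) :
    ValidState ch cap (fun _ => 1) ∅ ∅ where
  weight_pos _ _ := one_pos
  capped_subset := Finset.empty_subset _
  centers_subset := Finset.coe_empty.trans_subset (Set.empty_subset _)
  card_centers_le := Finset.card_empty.trans_le cap.zero_le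

lemma ValidState.next (hv : ValidState ch cap w S C) (α : ℝ) (x : X) (y : Bool) :
    ValidState ch cap (nextW ch.packing α w x y) (nextS ch w S) (nextC ch cap w S C) where
  weight_pos := nextW_pos hv.weight_pos x y
  capped_subset := nextS_subset w hv.capped_subset
  centers_subset := nextC_subset cap w S hv.centers_subset
  card_centers_le := card_nextC_le w S hv.card_centers_le

-- Two balls with more than half of the weight intersect.
lemma ball_subset_ball_center [IsFiniteMeasure D] (hw : ∀ h ∈ ch.packing, 0 < w h)
    (hP : ch.packing.Nonempty) {μ ν : X → Bool} (hν : ν ∈ H)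
    (hμheavy : 3 / 5 * ∑ h ∈ ch.packing, w h < ∑ h ∈ ball D ch.packing μ R, w h)
    (hνheavy : 3 / 5 * ∑ h ∈ ch.packing, w h < ∑ h ∈ ball D ch.packing ν R, w h) :
    ball D ch.packing μ R ⊆ ball D ch.packing (ch.center w) (3 * R) := by
  have hmax := ch.center_heaviest w ν hν
  simp only [ballMass_eq_sum_ball, posterior] at hmax
  rw [← Finset.sum_div, ← Finset.sum_div,
    div_le_div_iff_of_pos_right (Finset.sum_pos hw hP)] at hmax
  obtain ⟨g, hgμ, hgc⟩ := exists_mem_inter_of_heavy hw (ball_subset ..) (ball_subset ..) hμheavy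
    (hνheavy.trans_le hmax)
  intro h hh
  have hhμ := (mem_ball.1 hh).2
  have hgμ := hdist_comm D g μ ▸ (mem_ball.1 hgμ).2
  have hgc := (mem_ball.1 hgc).2
  refine mem_ball.2 ⟨(mem_ball.1 hh).1, ?_⟩
  linarith [hdist_triangle D h μ (ch.center w), hdist_triangle D μ g (ch.center w)]

lemma HeavyBall.potential_nextS_le [IsFiniteMeasure D] (h : HeavyBall ch w S)
    (hw : ∀ h ∈ ch.packing, 0 < w h) (hS : S ⊂ ch.packing) :
    potential ch.packing w (nextS ch w S) t ≤ 2 / 5 * potential ch.packing w S t := by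
  classical
  obtain ⟨μ, hμ, hmass⟩ := id h
  have hheavy := (weight_of_heavy hw hS (ball_subset D ch.packing μ R) hmass).1
  refine potential_le_of_heavy hw hS (ball_subset ..) hmass (subset_nextS ch w S) ?_
  rw [h.nextS_eq]
  exact (ball_subset_ball_center hw (nonempty_of_ssubset hS) hμ hheavy hheavy).trans
    Finset.subset_union_right

-- A ball that is heavy after the test would be part of the set that was just capped, and thus
-- carry no uncapped weight.
lemma ballMass_capped_nextS_le [IsFiniteMeasure D] (hw : ∀ h ∈ ch.packing, 0 < w h)
    (hS : nextS ch w S ⊂ ch.packing) {μ : X → Bool} (hμ : μ ∈ H) :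
    ballMass D ch.packing (capped (posterior ch.packing w) (nextS ch w S)) μ R ≤ 4 / 5 := by
  classical
  by_cases hheavy : HeavyBall ch w S
  · by_contra! hμmass
    obtain ⟨ν, hν, hνmass⟩ := id hheavy
    obtain ⟨hμheavy, hμfree⟩ := weight_of_heavy hw hS (ball_subset D ch.packing μ R) hμmass
    have hνheavy := (weight_of_heavy hw ((subset_nextS ch w S).trans_ssubset hS)
      (ball_subset D ch.packing ν R) hνmass).1
    have hcapped : ball D ch.packing μ R ⊆ nextS ch w S := by
      rw [hheavy.nextS_eq]
      exact (ball_subset_ball_center hw (nonempty_of_ssubset hS) hν hμheavy hνheavy).trans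
        Finset.subset_union_right
    have hfree : freeWeight w (nextS ch w S) (ball D ch.packing μ R) = 0 := by
      rw [freeWeight, Finset.sdiff_eq_empty_iff_subset.2 hcapped, Finset.sum_empty]
    linarith [freeWeight_pos hw hS]
  · rw [nextS_eq_of_not_heavyBall hheavy]
    exact not_lt.1 fun hmass => hheavy ⟨μ, hμ, hmass⟩

-- A new center pays a factor `2 / 5` in the potential for the one in the bound.
lemma potential_mul_pow_le [IsFiniteMeasure D] (hv : ValidState ch cap w S C)
    (hS : S ⊂ ch.packing) (ht : t ∈ ch.packing) (hroom : HeavyBall ch w S → C.card < cap) :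
    potential ch.packing w (nextS ch w S) t * (2 / 5) ^ (cap - (nextC ch cap w S C).card) ≤
      potential ch.packing w S t * (2 / 5) ^ (cap - C.card) := by
  classical
  by_cases h : HeavyBall ch w S
  · have hlt := hroom h
    have hΦ := (potential_pos hv.weight_pos hS ht).le
    have hcard : cap - C.card ≤ cap - (nextC ch cap w S C).card + 1 := by
      have := Finset.card_insert_le (ch.center w) C
      rw [h.nextC_eq hlt]
      omega
    calc potential ch.packing w (nextS ch w S) t * (2 / 5) ^ (cap - (nextC ch cap w S C).card)
        ≤ 2 / 5 * potential ch.packing w S t *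
            (2 / 5) ^ (cap - (nextC ch cap w S C).card) :=
          mul_le_mul_of_nonneg_right (h.potential_nextS_le hv.weight_pos hS) (by positivity)
      _ = potential ch.packing w S t *
            (2 / 5) ^ (cap - (nextC ch cap w S C).card + 1) := by ring
      _ ≤ potential ch.packing w S t * (2 / 5) ^ (cap - C.card) :=
          mul_le_mul_of_nonneg_left
            (pow_le_pow_of_le_one (by norm_num) (by norm_num) hcard) hΦ
  · rw [nextS_eq_of_not_heavyBall h, nextC_eq_of_not_heavyBall h]

lemma potential_nextS_le_potential [IsFiniteMeasure D] (hw : ∀ h ∈ ch.packing, 0 < w h)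
    (hS : S ⊂ ch.packing) (ht : t ∈ ch.packing) :
    potential ch.packing w (nextS ch w S) t ≤ potential ch.packing w S t := by
  by_cases h : HeavyBall ch w S
  · linarith [h.potential_nextS_le (t := t) hw hS, potential_pos hw hS ht]
  · rw [nextS_eq_of_not_heavyBall h]

lemma potential_mul_rounds_le [IsFiniteMeasure D] (hv : ValidState ch cap w S C)
    (hS : S ⊂ ch.packing) (ht : t ∈ ch.packing) (hroom : HeavyBall ch w S → C.card < cap) {e : ℝ}
    (he : 0 ≤ e) (he1 : e ≤ 1) (k : ℕ) :
    (e ^ k + (2 / 5) ^ (cap - (nextC ch cap w S C).card)) *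
        (potential ch.packing w (nextS ch w S) t * e) ≤
      potential ch.packing w S t * (e ^ (k + 1) + (2 / 5) ^ (cap - C.card)) := by
  have hcenters := potential_mul_pow_le hv hS ht hroom
  have hΦ := (potential_pos hv.weight_pos hS ht).le
  calc (e ^ k + (2 / 5) ^ (cap - (nextC ch cap w S C).card)) *
        (potential ch.packing w (nextS ch w S) t * e)
      = potential ch.packing w (nextS ch w S) t * e ^ (k + 1) +
          potential ch.packing w (nextS ch w S) t *
            (2 / 5) ^ (cap - (nextC ch cap w S C).card) * e := by ring
    _ ≤ potential ch.packing w S t * e ^ (k + 1) +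
          potential ch.packing w S t * (2 / 5) ^ (cap - C.card) * 1 :=
        add_le_add
          (mul_le_mul_of_nonneg_right (potential_nextS_le_potential hv.weight_pos hS ht)
            (by positivity))
          (mul_le_mul hcenters he1 he (by positivity))
    _ = potential ch.packing w S t * (e ^ (k + 1) + (2 / 5) ^ (cap - C.card)) := by ring

lemma exists_center_of_mem_nextS (htS : t ∉ S) (ht : t ∈ nextS ch w S)
    (hroom : HeavyBall ch w S → C.card < cap) :
    ∃ c ∈ nextC ch cap w S C, hdist D t c ≤ 3 * R := by
  classical
  by_cases h : HeavyBall ch w S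
  · rw [h.nextS_eq] at ht
    refine ⟨ch.center w, h.nextC_eq (hroom h) ▸ Finset.mem_insert_self _ _, ?_⟩
    exact (mem_ball.1 ((Finset.mem_union.1 ht).resolve_left htS)).2
  · exact absurd (nextS_eq_of_not_heavyBall h ▸ ht) htS

end Round

/-! ### The first stage -/

section StageOne

variable {X : Type*} [MeasurableSpace X] {D : Measure X} {H : Set (X → Bool)} {η R a T : ℝ}
  {w : (X → Bool) → ℝ} {S C : Finset (X → Bool)} {t : X → Bool}
  {κ : Kernel X Bool} [IsMarkovKernel κ] {E : (X → Bool) → ℕ → Prop}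
  {finish : Finset (X → Bool) → Learner X} {α γ r : ℝ} {cap N : ℕ}

lemma failureLE_stageOne_of_near (ch : Choices D H η R a T)
    (hfinish : ∀ C : Finset (X → Bool), (↑C : Set (X → Bool)) ⊆ H → C.card ≤ cap →
      (∃ c ∈ C, hdist D t c ≤ r) → (finish C).FailureLE κ E N γ) :
    ∀ (k : ℕ) (w : (X → Bool) → ℝ) (S C : Finset (X → Bool)) (n : ℕ),
      ValidState ch cap w S C → (∃ c ∈ C, hdist D t c ≤ r) → n + k = N →
      (stageOne ch α cap finish k w S C).FailureLE κ E n γ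
  | 0, _, _, C, _, hv, hnear, hn => by
    obtain rfl : _ = N := hn
    exact hfinish C hv.centers_subset hv.card_centers_le hnear
  | k + 1, w, S, C, n, hv, ⟨c, hcC, hc⟩, hn => by
    have := (ch.queryDist_optimal w _ (nextS_subset w hv.capped_subset)).1.1
    exact Learner.failureLE_query_const fun x y =>
      failureLE_stageOne_of_near ch hfinish k _ _ _ _ (hv.next α x y)
        ⟨c, subset_nextC ch cap w S C hcC, hc⟩ (by omega)

variable [IsProbabilityMeasure D] {c₄ c₅ ε β : ℝ}
  {ch : Choices D H η (c₄ * η + c₅ * ε) (c₄ / 20 * η) T}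

lemma le_integral_disagreement_sub_noise (hmeas : ∀ h ∈ H, Measurable h)
    (hval : HasQueryValue D H c₄ c₅ η ε β) (hw : ∀ h ∈ ch.packing, 0 < w h)
    (hS : nextS ch w S ⊂ ch.packing) (ht : t ∈ ch.packing) {b : ℝ} (hb : 0 ≤ b)
    (herr : b * err D κ t ≤ c₄ / 20 * η) :
    β ≤ ∫ x, (disagreement ch.packing (capped (posterior ch.packing w) (nextS ch w S)) t x -
      b * noise κ t x) ∂ch.queryDist w (nextS ch w S) := by
  have hcap := isDistribution_capped_posterior hw hS
  have hF (h) (hh : h ∈ ch.packing) : Measurable h := hmeas h (ch.packing_spec.1 hh)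
  obtain ⟨hq, hopt⟩ := ch.queryDist_optimal w _ hS.subset
  obtain ⟨q', hq', hβ⟩ := hval ch.packing _ ch.packing_spec.1 hcap
    fun μ hμ => ballMass_capped_nextS_le hw hS hμ
  calc β ≤ queryValue D (c₄ / 20 * η) _ q' := hβ
    _ ≤ queryValue D (c₄ / 20 * η) _ (ch.queryDist w (nextS ch w S)) := hopt q' hq'
    _ ≤ _ := hcap.queryValue_minority_le hF (hF t ht) hq hb herr

lemma failureLE_query_potential (hmeas : ∀ h ∈ H, Measurable h)
    (hval : HasQueryValue D H c₄ c₅ η ε β) (hα : 0 ≤ α) (hw : ∀ h ∈ ch.packing, 0 < w h)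
    (hS : nextS ch w S ⊂ ch.packing) (ht : t ∈ ch.packing)
    (herr : (1 + Real.exp (2 * α)) * err D κ t ≤ c₄ / 20 * η) {A : ℝ} (hA : 0 ≤ A) {n : ℕ}
    {next : X → Bool → Learner X}
    (hnext : ∀ x y, (next x y).FailureLE κ E (n + 1)
      (γ + A * potential ch.packing (nextW ch.packing α w x y) (nextS ch w S) t)) :
    (Learner.query (ch.queryDist w (nextS ch w S)) next).FailureLE κ E n
      (γ + A * (potential ch.packing w (nextS ch w S) t *
        Real.exp (-((1 - Real.exp (-(2 * α))) * β)))) := by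
  set Φ := potential ch.packing w (nextS ch w S) t
  set θ := 1 - Real.exp (-(2 * α))
  set gain := fun x =>
    disagreement ch.packing (capped (posterior ch.packing w) (nextS ch w S)) t x -
      (1 + Real.exp (2 * α)) * noise κ t x
  have hθ : 0 ≤ θ := sub_nonneg.2 (Real.exp_le_one_iff.2 (by linarith))
  have hF (h) (hh : h ∈ ch.packing) : Measurable h := hmeas h (ch.packing_spec.1 hh)
  have := (ch.queryDist_optimal w _ hS.subset).1.1
  have hgain : Integrable gain (ch.queryDist w (nextS ch w S)) :=
    ((isDistribution_capped_posterior hw hS).integrable_disagreement hF (hF t ht) _).sub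
      ((integrable_noise κ (hF t ht) _).const_mul _)
  have hΦ : 0 ≤ Φ := (potential_pos hw hS ht).le
  refine Learner.failureLE_query hnext (G := fun x => γ + A * Φ + -(A * Φ * θ) * gain x)
    ((integrable_const _).add (hgain.const_mul _)) (fun x => ?_) ?_
  · rw [integral_add_const_mul .of_finite]
    have hround := mul_le_mul_of_nonneg_left
      (integral_potential_nextW_le κ hα hw hS ht x) hA
    linarith
  · rw [integral_add_const_mul hgain]
    have hmean : β ≤ ∫ x, gain x ∂ch.queryDist w (nextS ch w S) :=
      le_integral_disagreement_sub_noise hmeas hval hw hS ht (by positivity) herr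
    calc γ + A * Φ + -(A * Φ * θ) * ∫ x, gain x ∂ch.queryDist w (nextS ch w S)
        ≤ γ + A * Φ + -(A * Φ * θ) * β :=
          add_le_add_right (mul_le_mul_of_nonpos_left hmean
            (neg_nonpos.2 (mul_nonneg (mul_nonneg hA hΦ) hθ))) _
      _ = γ + A * (Φ * (-(θ * β) + 1)) := by ring
      _ ≤ γ + A * (Φ * Real.exp (-(θ * β))) := by
          gcongr
          exact Real.add_one_le_exp _

-- The potential of `t` never drops below `1` while `t` is not capped, so the first stage fails to
-- find a center near `t` only if it runs out of rounds or of centers before the potential does.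
lemma failureLE_stageOne (hmeas : ∀ h ∈ H, Measurable h)
    (hval : HasQueryValue D H c₄ c₅ η ε β) (hβ : 0 ≤ β) (hα : 0 ≤ α) (ht : t ∈ ch.packing)
    (herr : (1 + Real.exp (2 * α)) * err D κ t ≤ c₄ / 20 * η) (hγ : 0 ≤ γ)
    (hfinish : ∀ C : Finset (X → Bool), (↑C : Set (X → Bool)) ⊆ H → C.card ≤ cap →
      (∃ c ∈ C, hdist D t c ≤ 3 * (c₄ * η + c₅ * ε)) → (finish C).FailureLE κ E N γ) :
    ∀ (k : ℕ) (w : (X → Bool) → ℝ) (S C : Finset (X → Bool)) (n : ℕ),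
      ValidState ch cap w S C → t ∉ S → n + k = N →
      (stageOne ch α cap finish k w S C).FailureLE κ E n
        (γ + potential ch.packing w S t *
          (Real.exp (-((1 - Real.exp (-(2 * α))) * β)) ^ k + (2 / 5) ^ (cap - C.card)))
  | 0, w, S, C, n, hv, htS, _ => by
    have hΦ := one_le_potential hv.weight_pos ht htS
    have hpow : 0 ≤ ((2 : ℝ) / 5) ^ (cap - C.card) := by positivity
    refine Learner.failureLE_of_one_le (le_add_of_nonneg_of_le hγ ?_)
    exact one_le_mul_of_one_le_of_one_le hΦ (by rw [pow_zero]; linarith)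
  | k + 1, w, S, C, n, hv, htS, hn => by
    have hΦ := one_le_potential hv.weight_pos ht htS
    have hS : S ⊂ ch.packing := (Finset.ssubset_iff_of_subset hv.capped_subset).2 ⟨t, ht, htS⟩
    set e := Real.exp (-((1 - Real.exp (-(2 * α))) * β))
    have he : 0 ≤ e := (Real.exp_pos _).le
    have he1 : e ≤ 1 := Real.exp_le_one_iff.2 <| neg_nonpos.2 <|
      mul_nonneg (sub_nonneg.2 (Real.exp_le_one_iff.2 (by linarith))) hβ
    by_cases hroom : HeavyBall ch w S → C.card < cap
    · by_cases ht' : t ∈ nextS ch w S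
      · have hnear := exists_center_of_mem_nextS htS ht' hroom
        have hvalid := hv.next α
        have hq := (ch.queryDist_optimal w _ (nextS_subset w hv.capped_subset)).1.1
        refine Learner.FailureLE.mono (Learner.failureLE_query_const fun x y =>
          failureLE_stageOne_of_near ch hfinish k _ _ _ _ (hvalid x y) hnear (by omega)) ?_
        exact le_add_of_nonneg_right (by positivity)
      · have hS' : nextS ch w S ⊂ ch.packing :=
          (Finset.ssubset_iff_of_subset (nextS_subset w hv.capped_subset)).2 ⟨t, ht, ht'⟩
        have hA : 0 ≤ e ^ k + (2 / 5) ^ (cap - (nextC ch cap w S C).card) := by positivity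
        refine (failureLE_query_potential hmeas hval hα hv.weight_pos hS' ht herr hA
          fun x y => ?_).mono (add_le_add_right (potential_mul_rounds_le hv hS ht hroom he he1 k) _)
        rw [mul_comm _ (potential _ _ _ _)]
        exact failureLE_stageOne hmeas hval hβ hα ht herr hγ hfinish k _ _ _ _ (hv.next α x y) ht'
          (by omega)
    · push Not at hroom
      refine Learner.failureLE_of_one_le (le_add_of_nonneg_of_le hγ ?_)
      refine one_le_mul_of_one_le_of_one_le hΦ ?_
      rw [Nat.sub_eq_zero_of_le hroom.2, pow_zero]
      linarith [pow_nonneg he (k + 1)]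

end StageOne

/-! ### Numerical estimates -/

section Numerics

variable {n c N δ : ℝ}

lemma one_le_logp (x : ℝ) : 1 ≤ logp x := le_max_left _ _

lemma log_le_logp (x : ℝ) : Real.log x ≤ logp x := le_max_right _ _

lemma logp_le_logp {x y : ℝ} (hx : 0 < x) (hxy : x ≤ y) : logp x ≤ logp y :=
  max_le_max le_rfl (Real.log_le_log hx hxy)

lemma exp_neg_logp_le_half (x : ℝ) : Real.exp (-logp x) ≤ 1 / 2 := by
  rw [Real.exp_neg, one_div]
  refine inv_anti₀ two_pos ?_
  linarith [Real.add_one_le_exp (logp x), one_le_logp x]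

lemma mul_exp_neg_logp_le (hn : 0 < n) (hδ : 0 < δ) : n * Real.exp (-logp (n / δ)) ≤ δ :=
  calc n * Real.exp (-logp (n / δ)) ≤ n * Real.exp (-Real.log (n / δ)) := by
        gcongr
        exact log_le_logp _
    _ = δ := by
        rw [Real.exp_neg, Real.exp_log (by positivity)]
        field_simp

lemma exp_pow_le_exp_neg_logp_pow {x ν : ℝ} {j k : ℕ} (h : j * logp x ≤ ν * k) :
    Real.exp (-ν) ^ k ≤ Real.exp (-logp x) ^ j := by
  rw [← Real.exp_nat_mul, ← Real.exp_nat_mul]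
  exact Real.exp_le_exp.2 (by linarith)

lemma sq_mul_exp_pow_le {ν : ℝ} {k : ℕ} (hn : 0 < n) (hδ : 0 < δ) (hδ1 : δ ≤ 1)
    (hk : 4 * logp (n / δ) ≤ ν * k) : n ^ 2 * Real.exp (-ν) ^ k ≤ δ / 4 := by
  have hpow := exp_pow_le_exp_neg_logp_pow (j := 4) (by exact_mod_cast hk)
  calc n ^ 2 * Real.exp (-ν) ^ k ≤ n ^ 2 * Real.exp (-logp (n / δ)) ^ 4 := by gcongr
    _ = (n * Real.exp (-logp (n / δ))) ^ 2 * Real.exp (-logp (n / δ)) ^ 2 := by ring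
    _ ≤ δ ^ 2 * (1 / 2) ^ 2 := by
        gcongr
        · exact mul_exp_neg_logp_le hn hδ
        · exact exp_neg_logp_le_half _
    _ ≤ δ / 4 := by nlinarith

lemma sq_mul_two_fifths_pow_le {k : ℕ} (hn : 0 < n) (hδ : 0 < δ) (hδ1 : δ ≤ 1)
    (hk : 8 * logp (n / δ) ≤ k) : n ^ 2 * (2 / 5 : ℝ) ^ k ≤ δ / 4 := by
  have h : (2 : ℝ) / 5 ≤ Real.exp (-(1 / 2)) := by
    linarith [Real.add_one_le_exp (-(1 / 2 : ℝ))]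
  calc n ^ 2 * (2 / 5 : ℝ) ^ k ≤ n ^ 2 * Real.exp (-(1 / 2)) ^ k := by gcongr
    _ ≤ δ / 4 := sq_mul_exp_pow_le hn hδ hδ1 (by linarith)

lemma sq_mul_exp_pow_add_pow_le {θ β r b : ℝ} {k cap : ℕ} (hn : 0 < n) (hδ : 0 < δ)
    (hδ1 : δ ≤ 1) (hθ : 0 ≤ θ) (hβ : 0 < β) (hr : 4 ≤ θ * r) (hb : 8 ≤ b)
    (hk : r * (1 / β) * logp (n / δ) ≤ k) (hcap : b * logp (n / δ) ≤ cap) :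
    n ^ 2 * (Real.exp (-(θ * β)) ^ k + (2 / 5) ^ cap) ≤ δ / 2 := by
  have hL : 0 ≤ logp (n / δ) := zero_le_one.trans (one_le_logp _)
  have hrounds : 4 * logp (n / δ) ≤ θ * β * k :=
    calc 4 * logp (n / δ) ≤ θ * r * logp (n / δ) := by gcongr
      _ = θ * β * (r * (1 / β) * logp (n / δ)) := by field_simp
      _ ≤ θ * β * k := by gcongr
  have hcenters : 8 * logp (n / δ) ≤ cap := hcap.trans' (by gcongr)
  linarith [sq_mul_exp_pow_le hn hδ hδ1 hrounds, sq_mul_two_fifths_pow_le hn hδ hδ1 hcenters]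

lemma mul_one_sub_pow_le {g : ℝ} {m : ℕ} (hc : 0 < c) (hδ : 0 < δ) (hg0 : 0 ≤ g)
    (hg : g ≤ 1 / 2) (hm : logp (c / δ) ≤ g ^ 2 * m) : c * (1 - 2 * g ^ 2) ^ m ≤ δ / 2 := by
  have hbase : 1 - 2 * g ^ 2 ≤ Real.exp (-(2 * g ^ 2)) := Real.one_sub_le_exp_neg _
  have hbase0 : 0 ≤ 1 - 2 * g ^ 2 := by nlinarith
  have hpow : Real.exp (-(2 * g ^ 2)) ^ m ≤ Real.exp (-logp (c / δ)) ^ 2 :=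
    exp_pow_le_exp_neg_logp_pow (by push_cast; linarith)
  calc c * (1 - 2 * g ^ 2) ^ m ≤ c * Real.exp (-logp (c / δ)) ^ 2 := by
        gcongr
        exact (pow_le_pow_left₀ hbase0 hbase m).trans hpow
    _ = c * Real.exp (-logp (c / δ)) * Real.exp (-logp (c / δ)) := by ring
    _ ≤ δ * (1 / 2) := by
        gcongr
        · exact mul_exp_neg_logp_le hc hδ
        · exact exp_neg_logp_le_half _
    _ = δ / 2 := by ring

lemma logp_div_le (hN : 0 < N) (hδ : 0 < δ) (hδ1 : δ ≤ 1) : logp (N / δ) ≤ logp N / δ := by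
  have hinv : 1 ≤ δ⁻¹ := (one_le_inv₀ hδ).2 hδ1
  have hone := one_le_logp N
  have hlog := Real.log_le_sub_one_of_pos (inv_pos.2 hδ)
  have hmul : logp N + (δ⁻¹ - 1) ≤ logp N * δ⁻¹ := by nlinarith
  rw [div_eq_mul_inv, div_eq_mul_inv]
  refine max_le (by linarith) ?_
  rw [Real.log_mul hN.ne' (inv_ne_zero hδ.ne')]
  linarith [log_le_logp N]

lemma logp_div_le_logp_logp {b : ℝ} (hb : 1 ≤ b) (hc : 0 < c) (hN : 0 < N) (hδ : 0 < δ)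
    (hδ1 : δ ≤ 1) (hcb : c ≤ b * logp (N / δ)) :
    logp (c / δ) ≤ (b + 1) * logp (logp N / δ) := by
  have hL := one_le_logp (logp N / δ)
  have hA : 1 / δ ≤ logp N / δ := by
    gcongr
    exact one_le_logp N
  have hA0 : 0 < logp N / δ := (one_div_pos.2 hδ).trans_le hA
  have hcA : c / δ ≤ b * (logp N / δ) ^ 2 :=
    calc c / δ ≤ b * logp (N / δ) * (1 / δ) := by
          rw [div_eq_mul_one_div]
          gcongr
      _ ≤ b * (logp N / δ) * (logp N / δ) := by
          gcongr
          exact logp_div_le hN hδ hδ1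
      _ = b * (logp N / δ) ^ 2 := by ring
  refine max_le (by nlinarith) ?_
  calc Real.log (c / δ) ≤ Real.log (b * (logp N / δ) ^ 2) :=
        Real.log_le_log (div_pos hc hδ) hcA
    _ = Real.log b + 2 * Real.log (logp N / δ) := by
        rw [Real.log_mul (by positivity) (by positivity), Real.log_pow, Nat.cast_ofNat]
    _ ≤ (b - 1) + 2 * logp (logp N / δ) := by
        gcongr
        · exact Real.log_le_sub_one_of_pos (by positivity)
        · exact log_le_logp _
    _ ≤ (b + 1) * logp (logp N / δ) := by nlinarith

lemma ceil_le_add_mul {x y s : ℝ} (hx : 0 ≤ x) (hy : 1 ≤ y) (hxy : x ≤ s * y) :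
    (⌈x⌉₊ : ℝ) ≤ (s + 1) * y := by
  linarith [Nat.ceil_lt_add_one hx]

end Numerics

/-- `(1/β) log⁺ (N/δ) + log⁺ (N/δ) log⁺ ((log⁺ N) / δ)`: the number of queries up to a constant
factor, for a cover number `N`. -/
noncomputable def complexity (N β δ : ℝ) : ℝ :=
  1 / β * logp (N / δ) + logp (N / δ) * logp (logp N / δ)

/-- The factor in front of `complexity` that the constants of the algorithm lead to; the summands
`1` absorb the rounding. -/
noncomputable def queryConst (p : Constants) : ℝ :=
  p.rounds + 1 + (p.centers + 1) * (p.centers + 2) * (p.samples + 1)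

lemma queries_le {p : Constants} (hrounds : 0 ≤ p.rounds) (hcenters : 0 ≤ p.centers)
    (hsamples : 0 ≤ p.samples) {n N c : ℕ} {δ β : ℝ} (hn : 0 < n) (hnN : n ≤ N) (hδ : 0 < δ)
    (hδ1 : δ ≤ 1) (hβ : 0 < β) (hc : 0 < c) (hcap : c ≤ ⌈p.centers * logp (n / δ)⌉₊) :
    ((⌈p.rounds * (1 / β) * logp (n / δ)⌉₊ + c * ⌈p.samples * logp (c / δ)⌉₊ : ℕ) : ℝ) ≤
      queryConst p * complexity N β δ := by
  set L := logp (N / δ)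
  set LL := logp (logp N / δ)
  have : (0 : ℝ) < n := Nat.cast_pos.2 hn
  have hN0 : (0 : ℝ) < N := Nat.cast_pos.2 (hn.trans_le hnN)
  have hL : 1 ≤ L := one_le_logp _
  have hLL : 1 ≤ LL := one_le_logp _
  have hLn : logp (n / δ) ≤ L := logp_le_logp (by positivity) (by gcongr)
  have hLn0 : 0 ≤ logp (n / δ) := zero_le_one.trans (one_le_logp _)
  have hlogc0 : 0 ≤ logp (c / δ) := zero_le_one.trans (one_le_logp _)
  have hcL : (c : ℝ) ≤ (p.centers + 1) * L :=
    (Nat.cast_le.2 hcap).trans (ceil_le_add_mul (by positivity) hL (by gcongr))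
  have hlogc : logp (c / δ) ≤ (p.centers + 2) * LL :=
    (logp_div_le_logp_logp (by linarith) (Nat.cast_pos.2 hc) hN0 hδ hδ1 hcL).trans_eq (by ring)
  have hround : (⌈p.rounds * (1 / β) * logp (n / δ)⌉₊ : ℝ) ≤ p.rounds * (1 / β * L) + 1 := by
    have := (Nat.ceil_lt_add_one (by positivity : 0 ≤ p.rounds * (1 / β) * logp (n / δ))).le
    have : p.rounds * (1 / β) * logp (n / δ) ≤ p.rounds * (1 / β) * L := by gcongr
    linarith
  have hsample : (⌈p.samples * logp (c / δ)⌉₊ : ℝ) ≤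
      (p.samples + 1) * ((p.centers + 2) * LL) :=
    ceil_le_add_mul (by positivity) (by nlinarith) (by gcongr)
  have hP : 0 ≤ 1 / β * L := by positivity
  have hQ : 1 ≤ L * LL := one_le_mul_of_one_le_of_one_le hL hLL
  have hK : 0 ≤ (p.centers + 1) * (p.centers + 2) * (p.samples + 1) := by positivity
  push_cast
  calc (⌈p.rounds * (1 / β) * logp (n / δ)⌉₊ : ℝ) + c * ⌈p.samples * logp (c / δ)⌉₊
      ≤ p.rounds * (1 / β * L) + 1 +
          (p.centers + 1) * L * ((p.samples + 1) * ((p.centers + 2) * LL)) := by gcongr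
    _ ≤ queryConst p * complexity N β δ := by
        rw [queryConst, complexity]
        nlinarith [mul_nonneg hK hP, mul_nonneg hrounds (zero_le_one.trans hQ)]

/-! ### The whole algorithm -/

section Algorithm

variable {X : Type*} [MeasurableSpace X] {D : Measure X} [IsProbabilityMeasure D]
  {H : Set (X → Bool)} {c₄ c₅ η ε β δ g : ℝ} {p : Constants}

/-- The requirements on the constants of the algorithm under which its two stages fail with
probability at most `δ / 2` each: for a target of error at most `3 * η`, the noise that the step
size `α` tolerates is covered by the penalty `c₄ / 20 * η`; a round shrinks the potential by a
factor `exp (-((1 - exp (-(2 * α))) * β))`, a new center by `2 / 5`; and `g` is the margin by which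
the good candidate beats one half in each comparison of the second stage. -/
structure Constants.Admissible (p : Constants) (c₄ g : ℝ) : Prop where
  step_pos : 0 < p.α
  step_le : 60 * (1 + Real.exp (2 * p.α)) ≤ c₄
  le_rounds : 4 ≤ (1 - Real.exp (-(2 * p.α))) * p.rounds
  le_centers : 8 ≤ p.centers
  margin_pos : 0 < g
  margin_lt : g < 1 / 2
  le_samples : 1 ≤ g ^ 2 * p.samples

namespace Constants.Admissible

lemma one_sub_exp_pos (hp : p.Admissible c₄ g) : 0 < 1 - Real.exp (-(2 * p.α)) :=
  sub_pos.2 (Real.exp_lt_one_iff.2 (by linarith [hp.step_pos]))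

lemma rounds_pos (hp : p.Admissible c₄ g) : 0 < p.rounds :=
  pos_of_mul_pos_right (zero_lt_four.trans_le hp.le_rounds) hp.one_sub_exp_pos.le

lemma centers_pos (hp : p.Admissible c₄ g) : 0 < p.centers :=
  (by norm_num : (0 : ℝ) < 8).trans_le hp.le_centers

lemma samples_pos (hp : p.Admissible c₄ g) : 0 < p.samples :=
  pos_of_mul_pos_right (one_pos.trans_le hp.le_samples) (sq_nonneg g)

lemma queryConst_pos (hp : p.Admissible c₄ g) : 0 < queryConst p := by
  have := hp.rounds_pos
  have := hp.centers_pos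
  have := hp.samples_pos
  rw [queryConst]
  positivity

end Constants.Admissible

lemma exists_admissible (hc₄ : 120 < c₄) (hg : 0 < g) (hg2 : g < 1 / 2) :
    ∃ p : Constants, p.Admissible c₄ g := by
  set α := Real.log (c₄ / 60 - 1) / 2
  have hα : 0 < α := half_pos (Real.log_pos (by linarith))
  have hexp : Real.exp (2 * α) = c₄ / 60 - 1 := by
    rw [mul_div_cancel₀ _ two_ne_zero, Real.exp_log (by linarith)]
  have hθ : 0 < 1 - Real.exp (-(2 * α)) := sub_pos.2 (Real.exp_lt_one_iff.2 (by linarith))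
  exact ⟨⟨α, 4 / (1 - Real.exp (-(2 * α))), 8, 1 / g ^ 2⟩, hα, by rw [hexp]; linarith,
    (mul_div_cancel₀ 4 hθ.ne').ge, le_rfl, hg, hg2, (mul_one_div_cancel (pow_pos hg 2).ne').ge⟩

lemma exists_margin {c₁ : ℝ} (hc₄ : 0 ≤ c₄) (hc₅ : 0 ≤ c₅) (hc₅' : c₅ < 1 / 9)
    (hc₁ : 9 * c₄ + 8 < (1 - 9 * c₅) * c₁) :
    ∃ g, 0 < g ∧ g < 1 / 2 ∧ ∀ η ε, 0 ≤ η → c₁ * η ≤ ε →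
      3 * η + 3 * (c₄ * η + c₅ * ε) ≤ (1 / 2 - g) * threshold η ε (c₄ * η + c₅ * ε) := by
  have hc₁0 : 0 < c₁ := pos_of_mul_pos_right (by linarith : 0 < (1 - 9 * c₅) * c₁) (by linarith)
  set q := (9 * c₄ + 8) / c₁
  have hq : 0 < q := by positivity
  have hq1 : q < 1 - 9 * c₅ := (div_lt_iff₀ hc₁0).2 hc₁
  refine ⟨(1 - 9 * c₅ - q) / 2, by linarith, by linarith, fun η ε hη hε => ?_⟩
  have hε0 : 0 ≤ ε := (mul_nonneg hc₁0.le hη).trans hε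
  have hqε : (9 * c₄ + 8) * η ≤ q * ε :=
    calc (9 * c₄ + 8) * η = q * (c₁ * η) := by rw [← mul_assoc, div_mul_cancel₀ _ hc₁0.ne']
      _ ≤ q * ε := by gcongr
  have hη_le : η ≤ 3 * η + 3 * (c₄ * η + c₅ * ε) := by
    linarith [mul_nonneg hc₄ hη, mul_nonneg hc₅ hε0]
  rw [threshold]
  linarith [mul_le_mul_of_nonneg_left hη_le (sub_nonneg.2 hq1.le)]

lemma failureLE_stageTwo_samples {R a T : ℝ} (ch : Choices D H η R a T)
    {κ : Kernel X Bool} [IsMarkovKernel κ] {E : (X → Bool) → ℕ → Prop} {c : X → Bool}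
    {C : Finset (X → Bool)} {n : ℕ} (hp : p.Admissible c₄ g) (hδ : 0 < δ)
    (hmeas : ∀ h ∈ C, Measurable h) (hcC : c ∈ C) (hc : err D κ c ≤ (1 / 2 - g) * T)
    (hE : ∀ h ∈ C, hdist D c h ≤ T →
      ∀ m ≤ n + C.card * ⌈p.samples * logp (C.card / δ)⌉₊, E h m) :
    (stageTwo ch ⌈p.samples * logp (C.card / δ)⌉₊ C.card C).FailureLE κ E n (δ / 2) := by
  have hC : (0 : ℝ) < C.card := Nat.cast_pos.2 (Finset.card_pos.2 ⟨c, hcC⟩)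
  have hT : 0 ≤ T :=
    nonneg_of_mul_nonneg_right ((err_nonneg D κ c).trans hc) (by linarith [hp.margin_lt])
  refine (failureLE_stageTwo ch hT hp.margin_pos.le hp.margin_lt.le hc C.card C n hmeas hcC le_rfl
    hE).mono (mul_one_sub_pow_le hC hδ hp.margin_pos.le hp.margin_lt.le ?_)
  have hL : 0 ≤ logp (C.card / δ) := zero_le_one.trans (one_le_logp _)
  calc logp (C.card / δ) ≤ g ^ 2 * p.samples * logp (C.card / δ) :=
        le_mul_of_one_le_left hL hp.le_samples
    _ = g ^ 2 * (p.samples * logp (C.card / δ)) := mul_assoc ..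
    _ ≤ g ^ 2 * ⌈p.samples * logp (C.card / δ)⌉₊ := by
        gcongr
        exact Nat.le_ceil _

lemma failureLE_algorithm (hmeas : ∀ h ∈ H, Measurable h) (hη : 0 ≤ η) (hδ : 0 < δ)
    (hδ1 : δ ≤ 1) (hβ : 0 < β) (hval : HasQueryValue D H c₄ c₅ η ε β) (hp : p.Admissible c₄ g)
    (hmargin : 3 * η + 3 * (c₄ * η + c₅ * ε) ≤ (1 / 2 - g) * threshold η ε (c₄ * η + c₅ * ε))
    (ch : Choices D H η (c₄ * η + c₅ * ε) (c₄ / 20 * η) (threshold η ε (c₄ * η + c₅ * ε)))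
    {κ : Kernel X Bool} [IsMarkovKernel κ] {E : (X → Bool) → ℕ → Prop} {t : X → Bool}
    (ht : t ∈ ch.packing) (herr : err D κ t ≤ 3 * η)
    (hE : ∀ C : Finset (X → Bool), ∀ h ∈ C, h ∈ H → err D κ h ≤ η + ε →
      C.card ≤ ⌈p.centers * logp (ch.packing.card / δ)⌉₊ →
      ∀ m ≤ ⌈p.rounds * (1 / β) * logp (ch.packing.card / δ)⌉₊ +
        C.card * ⌈p.samples * logp (C.card / δ)⌉₊, E h m) :
    (algorithm ch p β δ).FailureLE κ E 0 δ := by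
  have hP : (0 : ℝ) < ch.packing.card := Nat.cast_pos.2 (Finset.card_pos.2 ⟨t, ht⟩)
  have hnoise : (1 + Real.exp (2 * p.α)) * err D κ t ≤ c₄ / 20 * η :=
    calc (1 + Real.exp (2 * p.α)) * err D κ t ≤ (1 + Real.exp (2 * p.α)) * (3 * η) := by gcongr
      _ = 60 * (1 + Real.exp (2 * p.α)) / 20 * η := by ring
      _ ≤ c₄ / 20 * η := by
          gcongr
          exact hp.step_le
  refine (failureLE_stageOne hmeas hval hβ.le hp.step_pos.le ht hnoise (half_pos hδ).le ?_ _ _ _ _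
    _ (validState_init ch _) (Finset.notMem_empty t) (zero_add _)).mono ?_
  · rintro C hCH hcard ⟨c, hcC, hct⟩
    have hC (h) (hh : h ∈ C) : Measurable h := hmeas h (hCH hh)
    have htm := hmeas t (ch.packing_spec.1 ht)
    have hcerr : err D κ c ≤ 3 * η + 3 * (c₄ * η + c₅ * ε) :=
      (err_le_err_add_hdist κ (hC c hcC) htm).trans
        (add_le_add herr hct)
    refine failureLE_stageTwo_samples ch hp hδ hC hcC (hcerr.trans hmargin) fun h hh hch m hm =>
      hE C h hh (hCH hh) ?_ hcard m hm
    have hherr := err_le_err_add_hdist (D := D) κ (hC h hh) (hC c hcC)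
    rw [threshold] at hch
    linarith
  · rw [potential_one, Finset.card_empty, Nat.sub_zero]
    linarith [sq_mul_exp_pow_add_pow_le hP hδ hδ1 hp.one_sub_exp_pos.le hβ hp.le_rounds
      hp.le_centers (Nat.le_ceil _) (Nat.le_ceil (p.centers * logp (ch.packing.card / δ)))]

lemma solves_algorithm (hmeas : ∀ h ∈ H, Measurable h) (hcov : ∃ F, IsCover D H η F)
    (hη : 0 ≤ η) (hδ : 0 < δ) (hδ1 : δ ≤ 1) (hβ : 0 < β)
    (hval : HasQueryValue D H c₄ c₅ η ε β) (hp : p.Admissible c₄ g)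
    (hmargin : 3 * η + 3 * (c₄ * η + c₅ * ε) ≤ (1 / 2 - g) * threshold η ε (c₄ * η + c₅ * ε))
    (ch : Choices D H η (c₄ * η + c₅ * ε) (c₄ / 20 * η) (threshold η ε (c₄ * η + c₅ * ε))) :
    Solves (algorithm ch p β δ) H D η ε δ
      (queryConst p * complexity (coverNumber D H η) β δ) := by
  intro κ _ ⟨h, hh, herr⟩
  obtain ⟨t, ht, hht⟩ := ch.packing_spec.exists_hdist_le (by positivity) hh
  have htH := ch.packing_spec.1 ht
  have hterr : err D κ t ≤ 3 * η := by
    have := err_le_err_add_hdist (D := D) κ (hmeas t htH) (hmeas h hh)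
    linarith
  refine failureLE_algorithm hmeas hη hδ hδ1 hβ hval hp hmargin ch ht hterr
    fun C f hfC hf hferr hcard m hm => ⟨(Nat.cast_le.2 hm).trans ?_, hf, hferr⟩
  exact queries_le hp.rounds_pos.le hp.centers_pos.le hp.samples_pos.le (Finset.card_pos.2 ⟨t, ht⟩)
    (ch.packing_spec.card_le_coverNumber hcov) hδ hδ1 hβ (Finset.card_pos.2 ⟨f, hfC⟩) hcard

end Algorithm

end ActiveLearning

open ActiveLearning in
theorem theorem3_general (c₁ c₄ c₅ : ℝ) (hc₄ : 120 < c₄) (hc₅ : 0 ≤ c₅) (hc₅' : c₅ < 1 / 9)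
    (hc₁ : 9 * c₄ + 8 < (1 - 9 * c₅) * c₁) :
    ∃ (p : Constants) (K : ℝ),
      0 < p.α ∧ 0 < p.rounds ∧ 0 < p.centers ∧ 0 < p.samples ∧ 0 < K ∧
      ∀ (X : Type*) [MeasurableSpace X] (D : Measure X) [IsProbabilityMeasure D]
        (H : Set (X → Bool)) (η ε δ β : ℝ),
        H.Nonempty → (∀ h ∈ H, Measurable h) → (∃ F, IsCover D H η F) →
        0 ≤ η → c₁ * η ≤ ε → 0 < δ → δ < 1 → 0 < β → HasQueryValue D H c₄ c₅ η ε β →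
        Nonempty (Choices D H η (c₄ * η + c₅ * ε) (c₄ / 20 * η)
          (threshold η ε (c₄ * η + c₅ * ε))) ∧
        ∀ ch : Choices D H η (c₄ * η + c₅ * ε) (c₄ / 20 * η)
          (threshold η ε (c₄ * η + c₅ * ε)),
          Solves (algorithm ch p β δ) H D η ε δ
            (K * complexity (coverNumber D H η) β δ) := by
  obtain ⟨g, hg, hg2, hmargin⟩ := exists_margin (by linarith) hc₅ hc₅' hc₁
  obtain ⟨p, hp⟩ := exists_admissible hc₄ hg hg2
  refine ⟨p, queryConst p, hp.step_pos, hp.rounds_pos, hp.centers_pos, hp.samples_pos,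
    hp.queryConst_pos, ?_⟩
  intro X _ D _ H η ε δ β hH hmeas hcov hη hε hδ hδ1 hβ hval
  exact ⟨nonempty_choices hH hmeas hcov _ (by positivity) _,
    solves_algorithm hmeas hcov hη hδ hδ1.le hβ hval hp (hmargin η ε hη hε)⟩

theorem theorem3 (c₁ c₄ c₅ : ℝ) (hc₄ : 300 ≤ c₄) (hc₅ : c₅ = 1 / 10)
    (hc₁ : 90 * c₄ + 80 < c₁) :
    ∃ (p : ActiveLearning.Constants) (K : ℝ),
      0 < p.α ∧ 0 < p.rounds ∧ 0 < p.centers ∧ 0 < p.samples ∧ 0 < K ∧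
      ∀ (X : Type*) [MeasurableSpace X] (D : MeasureTheory.Measure X)
        [MeasureTheory.IsProbabilityMeasure D] (H : Set (X → Bool)) (η ε δ β : ℝ),
        H.Nonempty → (∀ h ∈ H, Measurable h) → (∃ F, ActiveLearning.IsCover D H η F) →
        0 ≤ η → c₁ * η ≤ ε → 0 < δ → δ < 1 → 0 < β →
        ActiveLearning.HasQueryValue D H c₄ c₅ η ε β →
        Nonempty (ActiveLearning.Choices D H η (c₄ * η + c₅ * ε) (c₄ / 20 * η)
          (ActiveLearning.threshold η ε (c₄ * η + c₅ * ε))) ∧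
        ∀ ch : ActiveLearning.Choices D H η (c₄ * η + c₅ * ε) (c₄ / 20 * η)
          (ActiveLearning.threshold η ε (c₄ * η + c₅ * ε)),
          ActiveLearning.Solves (ActiveLearning.algorithm ch p β δ) H D η ε δ
            (K * (1 / β * ActiveLearning.logp (ActiveLearning.coverNumber D H η / δ) +
              ActiveLearning.logp (ActiveLearning.coverNumber D H η / δ) *
                ActiveLearning.logp
                  (ActiveLearning.logp (ActiveLearning.coverNumber D H η) / δ))) :=
  theorem3_general c₁ c₄ c₅ (by linarith) (by linarith) (by linarith)
    (by rw [hc₅]; linarith)
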